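/- **Robustness of the noisy quantum walk on a 6-cycle.** Let $\mathcal H_c=\mathbb C^2$ have orthonormal basis $|L\rangle,|R\rangle$, let $\mathcal H_p=\mathbb C^6$ have orthonormal basis $|i\rangle$, $i\in\mathbb Z/6$, and let $\mathcal H=\mathcal H_c\otimes\mathcal H_p$. Let $H=\frac1{\sqrt2}\begin{pmatrix}1&1\\1&-1\end{pmatrix}$ act on $\mathcal H_c$, let $S|L,i\rangle=|L,i-1\rangle$, $S|R,i\rangle=|R,i+1\rangle$ on $\mathcal H$, and let $M=\{M_0,M_1\}$ be the position measurement $M_0=|1\rangle\langle 1|$, $M_1=\sum_{i\ne1}|i\rangle\langle i|$ (tensored with the identity on $\mathcal H_c$ when it acts on $\mathcal H$). Consider the quantum while-program $$QW_6\equiv p:=|0\rangle;\ c:=|L\rangle;\ \mathbf{while}\ M[p]=1\ \mathbf{do}\ (c:=H[c];\ c,p:=S[c,p]),$$ and its noisy version $\widetilde{QW}_6$, in which $H$ and $S$ are replaced by noisy applications with error probabilities $p_H,p_S\in[0,1]$ and error models $\Phi_H$ on $\mathcal H_c$ and $\Phi_S$ on $\mathcal H$ (arbitrary completely positive, trace-non-increasing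 maps); that is, a noisy application of $U$ has semantics $\rho\mapsto(1-p)U\rho U^\dagger+p\,\Phi(\rho)$. The semantics of a loop is the least upper bound, in the Löwner order $\sqsubseteq$, of the semantics of its finite unrollings. Put $$\varepsilon_H=p_H\|\Phi_H-H\circ H^\dagger\|_\diamond,\qquad \varepsilon_S=p_S\|\Phi_S-S\circ S^\dagger\|_\diamond,$$ where $\|\mathcal E-\mathcal F\|_\diamond=\sup_{\mathcal A,\rho}\frac12\|(\mathcal E\otimes I_{\mathcal A})(\rho)-(\mathcal F\otimes I_{\mathcal A})(\rho)\|_1$ over all finite-dimensional auxiliary spaces $\mathcal A$ and density operators $\rho$ on the enlarged space; $\|\mathcal E-\mathcal F\|_{Q,\lambda}$ is the same supremum restricted to $\rho$ with $\mathrm{tr}((Q\otimes I_{\mathcal A})\rho)\ge\lambda$. A noisy program $\widetilde P$ with ideal version $P$ is called $\varepsilon$-robust under $(Q,\lambda)$ if $\|[\![\widetilde P]\!]-[\![P]\!]\|_{Q,\lambda}\le\varepsilon$. Then: 1. The loop of $QW_6$ is $(\frac56,5)$-bounded: with $\mathcal E(\rho)=SH\,M_1\rho M_1^\dagger\,H^\dagger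 S^\dagger$ ($H$ acting as $H\otimes I$) and $\mathcal E^*$ its dual, given by $\mathrm{tr}(A\,\mathcal E(\rho))=\mathrm{tr}(\mathcal E^*(A)\rho)$, one has $$(\mathcal E^*)^5(M_1^\dagger M_1)\sqsubseteq\tfrac56\,M_1^\dagger M_1 .$$ 2. For all $p_H,p_S,\Phi_H,\Phi_S$, the noisy loop is $30(\varepsilon_H+\varepsilon_S)$-robust under $(I,0)$. 3. For all $p_H,p_S,\Phi_H,\Phi_S$, the whole noisy walk $\widetilde{QW}_6$ is $30(\varepsilon_H+\varepsilon_S)$-robust under $(I,0)$. -/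

import Mathlib

open scoped Kronecker Matrix ComplexOrder MatrixOrder NNReal ENNReal

namespace QuantumWhile

noncomputable section

/-! ### Superoperators

The Hilbert space `ℂ^n` is given by its finite index type `n` of computational basis states;
operators are matrices, the order `≤` on matrices is the Löwner order. -/

/-- Linear maps on operators over `ℂ^n`. -/
abbrev Superop (n : Type) : Type := Matrix n n ℂ →ₗ[ℂ] Matrix n n ℂ

/-- The superoperator `A ∘ A†`, i.e. `ρ ↦ A ρ A†`. -/
def sandwich {n : Type} [Fintype n] (A : Matrix n n ℂ) : Superop n where
  toFun ρ := A * ρ * Aᴴ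
  map_add' ρ σ := by rw [Matrix.mul_add, Matrix.add_mul]
  map_smul' c ρ := by simp

/-- `E ⊗ I` on `ℂ^n ⊗ ℂ^a`: the map `E` is applied to every block
`(⟨x| on the second factor) ρ (|y⟩ on the second factor)`. -/
def Superop.tensorId {n : Type} (E : Superop n) (a : Type) : Superop (n × a) where
  toFun ρ := Matrix.of fun x y =>
    E (ρ.submatrix (fun i => (i, x.2)) (fun j => (j, y.2))) x.1 y.1
  map_add' ρ σ := by
    ext x y
    simp [Matrix.submatrix_add]
  map_smul' c ρ := by
    ext x y
    simp [Matrix.submatrix_smul]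

/-- The Schrödinger-Heisenberg dual `E*`, determined by `tr (A E(ρ)) = tr (E*(A) ρ)`. -/
def Superop.dual {n : Type} [Fintype n] [DecidableEq n] (E : Superop n) : Superop n where
  toFun A := Matrix.of fun j i => (A * E (Matrix.single i j 1)).trace
  map_add' A B := by ext; simp [Matrix.add_mul]
  map_smul' c A := by ext; simp

/-- The defining property of the dual. -/
theorem Superop.trace_mul_dual {n : Type} [Fintype n] [DecidableEq n] (E : Superop n)
    (A ρ : Matrix n n ℂ) : (A * E ρ).trace = (E.dual A * ρ).trace := by
  conv_lhs => rw [Matrix.matrix_eq_sum_single ρ]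
  have h : ∀ i j, Matrix.single i j (ρ i j) = ρ i j • Matrix.single i j (1 : ℂ) := by
    intro i j; simp
  simp only [h, map_sum, map_smul, Matrix.mul_sum, Matrix.trace_sum, Matrix.mul_smul,
    Matrix.trace_smul, smul_eq_mul]
  rw [Matrix.trace, Finset.sum_comm]
  refine Finset.sum_congr rfl fun j _ => ?_
  rw [Matrix.diag_apply, Matrix.mul_apply]
  refine Finset.sum_congr rfl fun i _ => ?_
  simp [Superop.dual, mul_comm]

/-- Complete positivity: `E ⊗ I` preserves positive semidefiniteness for every finite-dimensional
auxiliary space. -/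
def Superop.IsCompletelyPositive {n : Type} (E : Superop n) : Prop :=
  ∀ (k : ℕ) (ρ : Matrix (n × Fin k) (n × Fin k) ℂ),
    ρ.PosSemidef → (E.tensorId (Fin k) ρ).PosSemidef

/-- `tr E(ρ) ≤ tr ρ` for all positive semidefinite `ρ`. -/
def Superop.IsTraceNonincreasing {n : Type} [Fintype n] (E : Superop n) : Prop :=
  ∀ ρ : Matrix n n ℂ, ρ.PosSemidef → (E ρ).trace.re ≤ ρ.trace.re

/-- An admissible superoperator: completely positive and trace-non-increasing. -/
structure QuantumOp (n : Type) [Fintype n] where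
  toSuperop : Superop n
  completelyPositive : toSuperop.IsCompletelyPositive
  traceNonincreasing : toSuperop.IsTraceNonincreasing

/-! ### Distances -/

/-- The trace norm: the sum of the singular values. For a Hermitian matrix this is the
sum of the absolute values of the eigenvalues. -/
def traceNorm {n : Type} [Fintype n] [DecidableEq n] (A : Matrix n n ℂ) : ℝ :=
  ∑ i, √((Matrix.isHermitian_conjTranspose_mul_self A).eigenvalues i)

/-- The trace distance. -/
def traceDist {n : Type} [Fintype n] [DecidableEq n] (ρ σ : Matrix n n ℂ) : ℝ :=
  1 / 2 * traceNorm (ρ - σ)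

/-- The diamond norm `‖E - F‖_⋄`: the supremum, over all finite-dimensional auxiliary spaces and
all density operators `ρ` on the enlarged space, of the trace distance of the outputs. -/
def diamondDist {n : Type} [Fintype n] [DecidableEq n] (E F : Superop n) : ℝ≥0∞ :=
  ⨆ (k : ℕ) (ρ : Matrix (n × Fin k) (n × Fin k) ℂ) (_ : ρ.PosSemidef ∧ ρ.trace = 1),
    ENNReal.ofReal (traceDist (E.tensorId (Fin k) ρ) (F.tensorId (Fin k) ρ))

/-- The `(Q, lam)`-diamond norm `‖E - F‖_{Q,lam}`: only inputs with `tr ((Q ⊗ I) ρ) ≥ lam`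
are considered. -/
def qDiamondDist {n : Type} [Fintype n] [DecidableEq n] (E F : Superop n)
    (Q : Matrix n n ℂ) (lam : ℝ) : ℝ≥0∞ :=
  ⨆ (k : ℕ) (ρ : Matrix (n × Fin k) (n × Fin k) ℂ)
    (_ : ρ.PosSemidef ∧ ρ.trace = 1 ∧
      lam ≤ ((Q ⊗ₖ (1 : Matrix (Fin k) (Fin k) ℂ)) * ρ).trace.re),
    ENNReal.ofReal (traceDist (E.tensorId (Fin k) ρ) (F.tensorId (Fin k) ρ))

/-! ### Registers and measurements -/

/-- A quantum register of a system with basis `n`: a tensor factor, given by a splitting of the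
basis states of the system into those of the register and those of the remaining variables. -/
structure Register (n : Type) where
  carrier : Type
  rest : Type
  [fintypeCarrier : Fintype carrier]
  [decEqCarrier : DecidableEq carrier]
  [fintypeRest : Fintype rest]
  [decEqRest : DecidableEq rest]
  split : n ≃ carrier × rest

attribute [instance] Register.fintypeCarrier Register.decEqCarrier
  Register.fintypeRest Register.decEqRest

/-- The operator `A ⊗ I` on the whole system, for an operator `A` on the register. -/
def Register.lift {n : Type} (q : Register n) (A : Matrix q.carrier q.carrier ℂ) :
    Matrix n n ℂ :=
  (A ⊗ₖ (1 : Matrix q.rest q.rest ℂ)).submatrix q.split q.split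

/-- The superoperator `E ⊗ I` on the whole system, for a superoperator `E` on the register. -/
def Register.liftSuperop {n : Type} (q : Register n) (E : Superop q.carrier) : Superop n :=
  (Matrix.reindexLinearEquiv ℂ ℂ q.split.symm q.split.symm).toLinearMap ∘ₗ
    E.tensorId q.rest ∘ₗ (Matrix.reindexLinearEquiv ℂ ℂ q.split q.split).toLinearMap

/-- A quantum measurement with `m` outcomes. -/
structure Measurement (n : Type) [Fintype n] [DecidableEq n] (m : ℕ) where
  op : Fin m → Matrix n n ℂ
  complete : ∑ i, (op i)ᴴ * op i = 1

/-! ### The quantum while-language and its noisy version -/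

/-- Ideal programs over a system with basis `n`:
`skip`, `q := |k⟩`, `q := U[q]`, `P₁; P₂`, `if M[q] = m → P_m`, `while M[q] = 1 do P`. -/
inductive Prog (n : Type) : Type 1
  | skip : Prog n
  | init (q : Register n) (k : q.carrier) : Prog n
  | unitary (q : Register n) (U : Matrix.unitaryGroup q.carrier ℂ) : Prog n
  | seq (P₁ P₂ : Prog n) : Prog n
  | cases (q : Register n) (m : ℕ) (M : Measurement q.carrier m) (P : Fin m → Prog n) : Prog n
  | loop (q : Register n) (M : Measurement q.carrier 2) (P : Prog n) : Prog n

/-- Noisy programs: a unitary `U` carries an error probability `p` and an error model `Φ`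
on the same register. -/
inductive NoisyProg (n : Type) : Type 1
  | skip : NoisyProg n
  | init (q : Register n) (k : q.carrier) : NoisyProg n
  | unitary (q : Register n) (U : Matrix.unitaryGroup q.carrier ℂ) (p : unitInterval)
      (Φ : QuantumOp q.carrier) : NoisyProg n
  | seq (P₁ P₂ : NoisyProg n) : NoisyProg n
  | cases (q : Register n) (m : ℕ) (M : Measurement q.carrier m) (P : Fin m → NoisyProg n) :
      NoisyProg n
  | loop (q : Register n) (M : Measurement q.carrier 2) (P : NoisyProg n) : NoisyProg n

/-- The ideal program of a noisy program: forget all `p` and `Φ`. -/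
def NoisyProg.ideal {n : Type} : NoisyProg n → Prog n
  | .skip => .skip
  | .init q k => .init q k
  | .unitary q U _ _ => .unitary q U
  | .seq P₁ P₂ => .seq P₁.ideal P₂.ideal
  | .cases q m M P => .cases q m M fun i => (P i).ideal
  | .loop q M P => .loop q M P.ideal

/-- Initialization of `q` to the basis state `k`: `ρ ↦ ∑ j, |k⟩⟨j| ρ |j⟩⟨k|`. -/
def initSem {n : Type} [Fintype n] (q : Register n) (k : q.carrier) : Superop n :=
  ∑ j, sandwich (q.lift (Matrix.single k j 1))

/-- The measurement branch `ρ ↦ M_i ρ M_i†`. -/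
def branch {n : Type} [Fintype n] (q : Register n) {m : ℕ} (M : Measurement q.carrier m)
    (i : Fin m) : Superop n :=
  sandwich (q.lift (M.op i))

/-- Denotation of the `k`-th unrolling `while^(k)` of a loop with body semantics `F`;
`while^(0)` aborts. -/
def unroll {n : Type} [Fintype n] (q : Register n) (M : Measurement q.carrier 2)
    (F : Superop n) : ℕ → Superop n
  | 0 => 0
  | k + 1 => branch q M 0 + unroll q M F k ∘ₗ F ∘ₗ branch q M 1

open Classical in
/-- Denotation of a loop: the superoperator whose value at each positive semidefinite `ρ` is the
least upper bound, in the Löwner order, of the values at `ρ` of the unrollings. (There is at most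
one, since the positive semidefinite matrices span.) -/
def loopSem {n : Type} [Fintype n] (q : Register n) (M : Measurement q.carrier 2)
    (F : Superop n) : Superop n :=
  if h : ∃ E : Superop n, ∀ ρ : Matrix n n ℂ, ρ.PosSemidef →
      IsLUB (Set.range fun k => unroll q M F k ρ) (E ρ)
  then h.choose else 0

/-- Denotational semantics of ideal programs. -/
def Prog.sem {n : Type} [Fintype n] : Prog n → Superop n
  | .skip => LinearMap.id
  | .init q k => initSem q k
  | .unitary q U => sandwich (q.lift (U : Matrix q.carrier q.carrier ℂ))
  | .seq P₁ P₂ => P₂.sem ∘ₗ P₁.sem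
  | .cases q _ M P => ∑ i, (P i).sem ∘ₗ branch q M i
  | .loop q M P => loopSem q M P.sem

/-- Denotational semantics of noisy programs. -/
def NoisyProg.sem {n : Type} [Fintype n] : NoisyProg n → Superop n
  | .skip => LinearMap.id
  | .init q k => initSem q k
  | .unitary q U p Φ =>
      (((1 - (p : ℝ) : ℝ) : ℂ)) • sandwich (q.lift (U : Matrix q.carrier q.carrier ℂ)) +
        (((p : ℝ) : ℂ)) • q.liftSuperop Φ.toSuperop
  | .seq P₁ P₂ => P₂.sem ∘ₗ P₁.sem
  | .cases q _ M P => ∑ i, (P i).sem ∘ₗ branch q M i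
  | .loop q M P => loopSem q M P.sem

/-- A loop `while M[q] = 1 do P` is `(a,k)`-bounded if `0 ≤ a < 1`, `k ≥ 1` and
`(E*)^k (M₁† M₁) ≤ a M₁† M₁`, where `E(ρ) = ⟦P⟧(M₁ ρ M₁†)`. -/
def Prog.IsBoundedLoop {n : Type} [Fintype n] [DecidableEq n] (a : ℝ) (k : ℕ) : Prog n → Prop
  | .loop q M P =>
      0 ≤ a ∧ a < 1 ∧ 1 ≤ k ∧
        (Superop.dual (P.sem ∘ₗ branch q M 1))^[k] ((q.lift (M.op 1))ᴴ * q.lift (M.op 1)) ≤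
          (a : ℂ) • ((q.lift (M.op 1))ᴴ * q.lift (M.op 1))
  | _ => False

/-- The noisy program `P` is `ε`-robust under `(Q, lam)`. -/
def NoisyProg.IsRobust {n : Type} [Fintype n] [DecidableEq n] (P : NoisyProg n)
    (Q : Matrix n n ℂ) (lam : ℝ) (ε : ℝ≥0) : Prop :=
  qDiamondDist P.sem P.ideal.sem Q lam ≤ (ε : ℝ≥0∞)

/-- The error `p ‖Φ - U ∘ U†‖_⋄` of a noisy application of `U`. -/
def unitaryError {n : Type} [Fintype n] [DecidableEq n] (U : Matrix.unitaryGroup n ℂ)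
    (p : unitInterval) (Φ : QuantumOp n) : ℝ≥0 :=
  unitInterval.toNNReal p *
    (diamondDist Φ.toSuperop (sandwich (U : Matrix n n ℂ))).toNNReal

/-! ### The quantum walk on a circle with `n` points

The coin basis is `Fin 2`, with `L = 0` and `R = 1`; the position basis is `ZMod n`. -/

/-- Basis states of the walk: coin and position. -/
abbrev WalkBasis (n : ℕ) : Type := Fin 2 × ZMod n

/-- The coin variable `c`. -/
def coinReg (n : ℕ) [NeZero n] : Register (WalkBasis n) where
  carrier := Fin 2
  rest := ZMod n
  split := Equiv.refl _

/-- The position variable `p`. -/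
def posReg (n : ℕ) [NeZero n] : Register (WalkBasis n) where
  carrier := ZMod n
  rest := Fin 2
  split := Equiv.prodComm _ _

/-- The register `c, p`. -/
def coinPosReg (n : ℕ) [NeZero n] : Register (WalkBasis n) where
  carrier := Fin 2 × ZMod n
  rest := Unit
  split := (Equiv.prodPUnit _).symm

/-- The Hadamard matrix. -/
def hadamardMatrix : Matrix (Fin 2) (Fin 2) ℂ :=
  ((1 / √2 : ℝ) : ℂ) • !![1, 1; 1, -1]

/-- The shift `S|L,i⟩ = |L,i-1⟩`, `S|R,i⟩ = |R,i+1⟩`. -/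
def shiftMatrix (n : ℕ) [NeZero n] : Matrix (Fin 2 × ZMod n) (Fin 2 × ZMod n) ℂ :=
  ∑ i : ZMod n, Matrix.single (0 : Fin 2) 0 (1 : ℂ) ⊗ₖ Matrix.single (i - 1) i (1 : ℂ) +
    ∑ i : ZMod n, Matrix.single (1 : Fin 2) 1 (1 : ℂ) ⊗ₖ Matrix.single (i + 1) i (1 : ℂ)

theorem shiftMatrix_apply (n : ℕ) [NeZero n] (x y : Fin 2 × ZMod n) :
    shiftMatrix n x y =
      if x.1 = y.1 ∧ x.2 = (if y.1 = 0 then y.2 - 1 else y.2 + 1) then 1 else 0 := by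
  obtain ⟨c, i⟩ := x
  obtain ⟨d, j⟩ := y
  simp only [shiftMatrix, Matrix.add_apply, Matrix.sum_apply, Matrix.kroneckerMap_apply,
    Matrix.single_apply, ite_and]
  fin_cases c <;> fin_cases d
  · simp
    rw [Finset.sum_eq_single j] <;> grind
  · simp
  · simp
  · simp
    rw [Finset.sum_eq_single j] <;> grind

/-- The Hadamard gate. -/
def hadamard : Matrix.unitaryGroup (Fin 2) ℂ :=
  ⟨hadamardMatrix, by
    rw [Matrix.mem_unitaryGroup_iff]
    have h : ((√2 : ℝ) : ℂ) * ((√2 : ℝ) : ℂ) = 2 := by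
      rw [← Complex.ofReal_mul, Real.mul_self_sqrt (by norm_num)]; norm_num
    have h0 : ((√2 : ℝ) : ℂ) ≠ 0 := by
      intro h'; rw [h'] at h; norm_num at h
    ext i j
    fin_cases i <;> fin_cases j <;>
      simp [hadamardMatrix, Matrix.mul_apply, Fin.sum_univ_two, Matrix.star_eq_conjTranspose] <;>
      field_simp <;> rw [pow_two, h] <;> norm_num⟩

/-- The shift operator as a unitary. -/
def shift (n : ℕ) [NeZero n] : Matrix.unitaryGroup (Fin 2 × ZMod n) ℂ :=
  ⟨shiftMatrix n, by
    rw [Matrix.mem_unitaryGroup_iff']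
    ext ⟨c, i⟩ ⟨d, j⟩
    simp only [Matrix.mul_apply, Matrix.star_eq_conjTranspose, Matrix.conjTranspose_apply,
      shiftMatrix_apply, Fintype.sum_prod_type, Matrix.one_apply]
    fin_cases c <;> fin_cases d <;> simp [eq_comm]⟩

/-- The measurement `M₀ = |1⟩⟨1|`, `M₁ = ∑_{i ≠ 1} |i⟩⟨i|` of the position. -/
def walkMeasurement (n : ℕ) [NeZero n] : Measurement (ZMod n) 2 where
  op := ![Matrix.single 1 1 1, ∑ i ∈ Finset.univ.filter (fun i : ZMod n => i ≠ 1),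
    Matrix.single i i 1]
  complete := by
    have h1 : (Matrix.single 1 1 1 : Matrix (ZMod n) (ZMod n) ℂ) =
        Matrix.diagonal fun i => if i = 1 then 1 else 0 := by
      ext i j
      simp only [Matrix.single_apply, Matrix.diagonal_apply]
      grind
    have h2 : (∑ i ∈ Finset.univ.filter (fun i : ZMod n => i ≠ 1), Matrix.single i i 1 :
        Matrix (ZMod n) (ZMod n) ℂ) = Matrix.diagonal fun i => if i = 1 then 0 else 1 := by
      ext i j
      simp only [Matrix.sum_apply, Matrix.single_apply, Matrix.diagonal_apply, ite_and]
      rw [Finset.sum_ite_eq' (Finset.univ.filter (fun i : ZMod n => i ≠ 1)) i]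
      simp only [Finset.mem_filter, Finset.mem_univ, true_and]
      grind
    rw [Fin.sum_univ_two, Matrix.cons_val_zero, Matrix.cons_val_one, h1, h2]
    simp only [Matrix.cons_val_fin_one, Matrix.diagonal_conjTranspose,
      Matrix.diagonal_mul_diagonal, Matrix.diagonal_add]
    rw [← Matrix.diagonal_one]
    congr 1
    ext i
    by_cases h : i = 1 <;> simp [h]

/-- The loop `while M[p] = 1 do (c := H[c]; c,p := S[c,p])`. -/
def walkLoop (n : ℕ) [NeZero n] : Prog (WalkBasis n) :=
  .loop (posReg n) (walkMeasurement n)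
    (.seq (.unitary (coinReg n) hadamard) (.unitary (coinPosReg n) (shift n)))

/-- The quantum walk `p := |0⟩; c := |L⟩; while …`. -/
def walk (n : ℕ) [NeZero n] : Prog (WalkBasis n) :=
  .seq (.init (posReg n) (0 : ZMod n)) (.seq (.init (coinReg n) (0 : Fin 2)) (walkLoop n))

/-- The loop of the noisy walk, with noisy gates `H` and `S`. -/
def noisyWalkLoop (n : ℕ) [NeZero n] (pH pS : unitInterval) (ΦH : QuantumOp (Fin 2))
    (ΦS : QuantumOp (Fin 2 × ZMod n)) : NoisyProg (WalkBasis n) :=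
  .loop (posReg n) (walkMeasurement n)
    (.seq (.unitary (coinReg n) hadamard pH ΦH) (.unitary (coinPosReg n) (shift n) pS ΦS))

/-- The noisy quantum walk. -/
def noisyWalk (n : ℕ) [NeZero n] (pH pS : unitInterval) (ΦH : QuantumOp (Fin 2))
    (ΦS : QuantumOp (Fin 2 × ZMod n)) : NoisyProg (WalkBasis n) :=
  .seq (.init (posReg n) (0 : ZMod n))
    (.seq (.init (coinReg n) (0 : Fin 2)) (noisyWalkLoop n pH pS ΦH ΦS))

theorem noisyWalk_ideal (n : ℕ) [NeZero n] (pH pS : unitInterval) (ΦH : QuantumOp (Fin 2))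
    (ΦS : QuantumOp (Fin 2 × ZMod n)) : (noisyWalk n pH pS ΦH ΦS).ideal = walk n := rfl

end

end QuantumWhile

/-!
The error of a loop is controlled by the ideal loop alone. Write `B₀`, `B₁` for the two measurement
branches, `F` and `F'` for the ideal and the noisy body, `G = F ∘ B₁`, and `W_N`, `W'_N` for the
unrollings. From `W_{N+1} = B₀ + W_N ∘ F ∘ B₁` one gets the telescoping sum
`W'_N - W_N = ∑_{j < N} W'_{N-1-j} ∘ (F' - F) ∘ B₁ ∘ G^j`. The maps `W'_i` contract the trace norm,
and `F' - F` is small relative to the trace of its input, so the `j`-th summand costs the error of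
the body times the probability `tr (B₁ (G^j ρ))` that the ideal loop enters round `j + 1`
(`isTraceBounded_unroll_sub`). For an `(α, k)`-bounded loop, these probabilities do not increase and
shrink by the factor `α` every `k` rounds, so they sum to at most `k / (1 - α)` (`sum_enter_le`).
The unrollings converge to the loop (`tendsto_unroll`) and the trace norm is lower semicontinuous,
so the bound passes to the limit (`errorLE_loopSem`). Here `5 / (1 - 5 / 6) = 30`.

Trace norms are handled through Jordan decompositions: a Hermitian matrix has trace norm at most `c`
exactly if it is a difference of positive semidefinite matrices of total trace at most `c`
(`isTraceBounded_iff`). In this form subadditivity and contraction under positive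
trace-non-increasing maps are immediate.

The walk on the 6-cycle is `(5 / 6, 5)`-bounded because `(E*)^5 (M₁† M₁) = (K^5)† M₁† M₁ K^5` for
the operator `K = S H M₁`, so that the claim compares two quadratic forms in the amplitudes. Apart
from the factor `1 / √2` of the Hadamard matrix, `K` has integer entries, so the comparison reduces
to a rational quadratic form in ten real variables, which is a sum of squares
(`sum_sq_maskAmp_iterate_five_le`).
-/

namespace QuantumWhile

/-! ### Trace norm bounds through Jordan decompositions -/

section TraceBound

open Filter Topology

variable {n m : Type} [Fintype n] [Fintype m]

theorem trace_re_nonneg {A : Matrix n n ℂ} (hA : A.PosSemidef) : 0 ≤ A.trace.re :=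
  (Complex.nonneg_iff.1 hA.trace_nonneg).1

/-- The Hermitian matrices of trace norm at most `c`, described by Jordan decompositions: `A` is a
difference of positive semidefinite matrices of total trace at most `c`. The agreement with
`traceNorm` is `isTraceBounded_iff`. -/
def IsTraceBounded (A : Matrix n n ℂ) (c : ℝ) : Prop :=
  ∃ P Q : Matrix n n ℂ, P.PosSemidef ∧ Q.PosSemidef ∧ A = P - Q ∧ P.trace.re + Q.trace.re ≤ c

theorem IsTraceBounded.isHermitian {A : Matrix n n ℂ} {c : ℝ} (h : IsTraceBounded A c) :
    A.IsHermitian := by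
  obtain ⟨P, Q, hP, hQ, rfl, -⟩ := h
  exact hP.isHermitian.sub hQ.isHermitian

theorem IsTraceBounded.mono {A : Matrix n n ℂ} {c d : ℝ} (h : IsTraceBounded A c) (hcd : c ≤ d) :
    IsTraceBounded A d := by
  obtain ⟨P, Q, hP, hQ, hA, hc⟩ := h
  exact ⟨P, Q, hP, hQ, hA, hc.trans hcd⟩

theorem isTraceBounded_zero : IsTraceBounded (0 : Matrix n n ℂ) 0 :=
  ⟨0, 0, .zero, .zero, by simp, by simp⟩

theorem IsTraceBounded.add {A B : Matrix n n ℂ} {c d : ℝ} (hA : IsTraceBounded A c)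
    (hB : IsTraceBounded B d) : IsTraceBounded (A + B) (c + d) := by
  obtain ⟨P, Q, hP, hQ, rfl, hc⟩ := hA
  obtain ⟨P', Q', hP', hQ', rfl, hd⟩ := hB
  refine ⟨P + P', Q + Q', hP.add hP', hQ.add hQ', by abel, ?_⟩
  simp only [Matrix.trace_add, Complex.add_re]
  linarith

theorem IsTraceBounded.smul {A : Matrix n n ℂ} {c : ℝ} (hA : IsTraceBounded A c) {r : ℝ}
    (hr : 0 ≤ r) : IsTraceBounded ((r : ℂ) • A) (r * c) := by
  obtain ⟨P, Q, hP, hQ, rfl, hc⟩ := hA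
  have hr' : (0 : ℂ) ≤ (r : ℂ) := Complex.zero_le_real.2 hr
  refine ⟨(r : ℂ) • P, (r : ℂ) • Q, hP.smul hr', hQ.smul hr', smul_sub _ _ _, ?_⟩
  simp only [Matrix.trace_smul, smul_eq_mul, Complex.re_ofReal_mul]
  nlinarith

theorem trace_submatrix_equiv (A : Matrix n n ℂ) (e : m ≃ n) :
    (A.submatrix e e).trace = A.trace := by
  simp only [Matrix.trace, Matrix.diag_apply, Matrix.submatrix_apply]
  exact e.sum_comp fun i => A i i

theorem IsTraceBounded.submatrix_equiv {A : Matrix n n ℂ} {c : ℝ} (hA : IsTraceBounded A c)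
    (e : m ≃ n) : IsTraceBounded (A.submatrix e e) c := by
  obtain ⟨P, Q, hP, hQ, rfl, hc⟩ := hA
  refine ⟨_, _, hP.submatrix e, hQ.submatrix e, by rw [Matrix.submatrix_sub]; rfl, ?_⟩
  simpa only [trace_submatrix_equiv] using hc

/-- A positive trace-non-increasing linear map contracts the trace norm. -/
theorem IsTraceBounded.map {A : Matrix n n ℂ} {c : ℝ} (hA : IsTraceBounded A c)
    {E : Matrix n n ℂ →ₗ[ℂ] Matrix m m ℂ} (hpos : ∀ ρ, ρ.PosSemidef → (E ρ).PosSemidef)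
    (htr : ∀ ρ, ρ.PosSemidef → (E ρ).trace.re ≤ ρ.trace.re) : IsTraceBounded (E A) c := by
  obtain ⟨P, Q, hP, hQ, rfl, hc⟩ := hA
  exact ⟨E P, E Q, hpos P hP, hpos Q hQ, map_sub _ _ _, by linarith [htr P hP, htr Q hQ]⟩

theorem isClosed_posSemidef : IsClosed {A : Matrix n n ℂ | A.PosSemidef} := by
  have : {A : Matrix n n ℂ | A.PosSemidef} =
      {A | Aᴴ = A} ∩ ⋂ x : n → ℂ, {A | 0 ≤ star x ⬝ᵥ (A.mulVec x)} := by
    ext A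
    simp [Matrix.posSemidef_iff_dotProduct_mulVec, Matrix.IsHermitian]
  rw [this]
  refine (isClosed_eq (by fun_prop) continuous_id).inter (isClosed_iInter fun x => ?_)
  exact isClosed_le continuous_const (by fun_prop)

/-- The entries of a positive semidefinite matrix are bounded by its trace. -/
theorem norm_apply_le_trace {A : Matrix n n ℂ} (hA : A.PosSemidef) (i j : n) :
    ‖A i j‖ ≤ A.trace.re := by
  have hdiag : ∀ i, 0 ≤ (A i i).re ∧ (A i i).im = 0 := fun i => by
    have := Complex.nonneg_iff.1 (hA.diag_nonneg (i := i))
    exact ⟨this.1, this.2.symm⟩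
  have hle : ∀ i, (A i i).re ≤ A.trace.re := fun i => by
    rw [Matrix.trace, Complex.re_sum]
    exact Finset.single_le_sum (f := fun i => (A i i).re) (fun i _ => (hdiag i).1)
      (Finset.mem_univ i)
  -- the `2 × 2` minor at `i, j` bounds `‖A i j‖ ^ 2` by the product of two diagonal entries
  have hdet := (Complex.nonneg_iff.1 (hA.submatrix ![i, j]).det_nonneg).1
  rw [Matrix.det_fin_two] at hdet
  simp only [Matrix.submatrix_apply, Matrix.cons_val_zero, Matrix.cons_val_one,
    Matrix.cons_val_fin_one] at hdet
  rw [← hA.isHermitian.apply j i, Complex.sub_re, Complex.mul_re, (hdiag i).2, RCLike.star_def,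
    Complex.mul_conj, Complex.ofReal_re, Complex.normSq_eq_norm_sq] at hdet
  refine le_of_sq_le_sq (b := A.trace.re) ?_ ((hdiag i).1.trans (hle i))
  nlinarith [hle i, hle j, (hdiag i).1, (hdiag j).1]

variable [DecidableEq n]

/-- In every orthonormal basis, the diagonal entries of a matrix of trace norm at most `c` have
total modulus at most `c`. -/
theorem IsTraceBounded.sum_norm_diag_le {A : Matrix n n ℂ} {c : ℝ} (hA : IsTraceBounded A c)
    (U : Matrix.unitaryGroup n ℂ) :
    ∑ i, ‖((U : Matrix n n ℂ)ᴴ * A * (U : Matrix n n ℂ)) i i‖ ≤ c := by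
  obtain ⟨P, Q, hP, hQ, rfl, hc⟩ := hA
  have key : ∀ R : Matrix n n ℂ, R.PosSemidef →
      ∑ i, ‖((U : Matrix n n ℂ)ᴴ * R * (U : Matrix n n ℂ)) i i‖ = R.trace.re := by
    intro R hR
    have h1 := hR.conjTranspose_mul_mul_same (U : Matrix n n ℂ)
    have h2 : ((U : Matrix n n ℂ)ᴴ * R * (U : Matrix n n ℂ)).trace = R.trace := by
      rw [Matrix.trace_mul_comm, ← Matrix.mul_assoc]
      have : (U : Matrix n n ℂ) * (U : Matrix n n ℂ)ᴴ = 1 :=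
        Matrix.mem_unitaryGroup_iff.1 U.2
      rw [this, Matrix.one_mul]
    rw [← h2, Matrix.trace, Complex.re_sum]
    refine Finset.sum_congr rfl fun i _ => ?_
    have h3 := h1.diag_nonneg (i := i)
    rw [Matrix.diag_apply]
    exact (Complex.norm_of_nonneg' h3 |> congrArg Complex.re)
  calc _ ≤ ∑ i, (‖((U : Matrix n n ℂ)ᴴ * P * (U : Matrix n n ℂ)) i i‖
          + ‖((U : Matrix n n ℂ)ᴴ * Q * (U : Matrix n n ℂ)) i i‖) := by
        refine Finset.sum_le_sum fun i _ => ?_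
        rw [Matrix.mul_sub, Matrix.sub_mul, Matrix.sub_apply]
        exact norm_sub_le _ _
    _ ≤ c := by rw [Finset.sum_add_distrib, key P hP, key Q hQ]; exact hc

theorem diagonalization (A : Matrix n n ℂ) (hA : A.IsHermitian) :
    A = (hA.eigenvectorUnitary : Matrix n n ℂ) *
      Matrix.diagonal (fun i => (hA.eigenvalues i : ℂ)) *
        (hA.eigenvectorUnitary : Matrix n n ℂ)ᴴ :=
  hA.spectral_theorem

theorem conjTranspose_mul_mul_eigenvectorUnitary (A : Matrix n n ℂ) (hA : A.IsHermitian) :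
    (hA.eigenvectorUnitary : Matrix n n ℂ)ᴴ * A * (hA.eigenvectorUnitary : Matrix n n ℂ) =
      Matrix.diagonal fun i => (hA.eigenvalues i : ℂ) := by
  have hU : (hA.eigenvectorUnitary : Matrix n n ℂ)ᴴ * (hA.eigenvectorUnitary : Matrix n n ℂ) = 1 :=
    Matrix.mem_unitaryGroup_iff'.1 hA.eigenvectorUnitary.2
  have hD := congrArg (fun B => (hA.eigenvectorUnitary : Matrix n n ℂ)ᴴ * B *
    (hA.eigenvectorUnitary : Matrix n n ℂ)) (diagonalization A hA)
  refine hD.trans ?_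
  simp only [Matrix.mul_assoc, hU, Matrix.mul_one]
  rw [← Matrix.mul_assoc, hU, Matrix.one_mul]

open Polynomial in
/-- The singular values of a Hermitian matrix are the absolute values of its eigenvalues. -/
theorem traceNorm_eq_sum_abs_eigenvalues (A : Matrix n n ℂ) (hA : A.IsHermitian) :
    traceNorm A = ∑ i, |hA.eigenvalues i| := by
  have hB := Matrix.isHermitian_conjTranspose_mul_self A
  have hU : (hA.eigenvectorUnitary : Matrix n n ℂ)ᴴ * (hA.eigenvectorUnitary : Matrix n n ℂ) = 1 :=
    Matrix.mem_unitaryGroup_iff'.1 hA.eigenvectorUnitary.2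
  have h1 : Aᴴ * A = (hA.eigenvectorUnitary : Matrix n n ℂ) *
      (Matrix.diagonal (fun i => ((hA.eigenvalues i ^ 2 : ℝ) : ℂ)) *
        (hA.eigenvectorUnitary : Matrix n n ℂ)ᴴ) := by
    rw [hA.eq]
    conv_lhs => rw [diagonalization A hA]
    simp only [Matrix.mul_assoc]
    rw [← Matrix.mul_assoc _ _ (Matrix.diagonal _ * _), hU, Matrix.one_mul,
      ← Matrix.mul_assoc (Matrix.diagonal _) (Matrix.diagonal _), Matrix.diagonal_mul_diagonal]
    simp only [pow_two, Complex.ofReal_mul]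
  have h2 : (Aᴴ * A).charpoly = ∏ i, (X - C ((hA.eigenvalues i ^ 2 : ℝ) : ℂ)) := by
    rw [h1, Matrix.charpoly_mul_comm, Matrix.mul_assoc, hU, Matrix.mul_one,
      Matrix.charpoly_diagonal]
  have h3 := hB.roots_charpoly_eq_eigenvalues
  rw [h2, Polynomial.roots_prod _ _ (Finset.prod_ne_zero_iff.2 fun i _ => X_sub_C_ne_zero _)] at h3
  -- sum the square roots over the multiset of eigenvalues of `Aᴴ * A`
  have h4 := congrArg (fun s => (s.map fun z : ℂ => √z.re).sum) h3
  simp only [roots_X_sub_C, Multiset.bind_singleton, Multiset.map_map, Function.comp_def,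
    Complex.ofReal_re, Real.sqrt_sq_eq_abs] at h4
  exact h4.symm

theorem isTraceBounded_traceNorm {A : Matrix n n ℂ} (hA : A.IsHermitian) :
    IsTraceBounded A (traceNorm A) := by
  set U := (hA.eigenvectorUnitary : Matrix n n ℂ) with hUdef
  have hU : Uᴴ * U = 1 := Matrix.mem_unitaryGroup_iff'.1 hA.eigenvectorUnitary.2
  have htr : ∀ d : n → ℝ, (U * Matrix.diagonal (fun i => (d i : ℂ)) * Uᴴ).trace.re = ∑ i, d i := by
    intro d
    rw [Matrix.trace_mul_comm, ← Matrix.mul_assoc, hU, Matrix.one_mul, Matrix.trace_diagonal,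
      Complex.re_sum]
    simp
  refine ⟨U * Matrix.diagonal (fun i => (((hA.eigenvalues i)⁺ : ℝ) : ℂ)) * Uᴴ,
    U * Matrix.diagonal (fun i => (((hA.eigenvalues i)⁻ : ℝ) : ℂ)) * Uᴴ, ?_, ?_, ?_, ?_⟩
  · exact (Matrix.PosSemidef.diagonal fun i =>
      Complex.zero_le_real.2 (posPart_nonneg _)).mul_mul_conjTranspose_same U
  · exact (Matrix.PosSemidef.diagonal fun i =>
      Complex.zero_le_real.2 (negPart_nonneg _)).mul_mul_conjTranspose_same U
  · rw [← Matrix.sub_mul, ← Matrix.mul_sub, Matrix.diagonal_sub]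
    conv_lhs => rw [diagonalization A hA]
    congr 3
    ext i
    rw [← Complex.ofReal_sub, posPart_sub_negPart]
  · rw [htr, htr, traceNorm_eq_sum_abs_eigenvalues A hA, ← Finset.sum_add_distrib]
    refine Finset.sum_le_sum fun i _ => (posPart_add_negPart _).le

theorem isTraceBounded_iff {A : Matrix n n ℂ} {c : ℝ} :
    IsTraceBounded A c ↔ A.IsHermitian ∧ traceNorm A ≤ c := by
  refine ⟨fun h => ⟨h.isHermitian, ?_⟩, fun h => (isTraceBounded_traceNorm h.1).mono h.2⟩
  have hA := h.isHermitian
  have := h.sum_norm_diag_le hA.eigenvectorUnitary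
  rw [conjTranspose_mul_mul_eigenvectorUnitary] at this
  rw [traceNorm_eq_sum_abs_eigenvalues A hA]
  simpa using this

/-- The trace norm is lower semicontinuous. -/
theorem IsTraceBounded.of_tendsto {A : ℕ → Matrix n n ℂ} {B : Matrix n n ℂ} {c : ℝ}
    (hA : ∀ k, IsTraceBounded (A k) c) (hlim : Tendsto A atTop (𝓝 B)) : IsTraceBounded B c := by
  have hB : B.IsHermitian := by
    have h1 : IsClosed {A : Matrix n n ℂ | Aᴴ = A} :=
      isClosed_eq (by fun_prop) continuous_id
    exact h1.mem_of_tendsto hlim (Eventually.of_forall fun k => (hA k).isHermitian)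
  refine isTraceBounded_iff.2 ⟨hB, ?_⟩
  -- The bound on the diagonal in a fixed basis is a closed condition; an eigenbasis of the limit
  -- turns it into the bound on the trace norm.
  have h2 : IsClosed {A : Matrix n n ℂ | ∑ i, ‖((hB.eigenvectorUnitary : Matrix n n ℂ)ᴴ * A *
      (hB.eigenvectorUnitary : Matrix n n ℂ)) i i‖ ≤ c} := by
    refine isClosed_le ?_ continuous_const
    refine continuous_finsetSum _ fun i _ => ?_
    refine Continuous.norm ?_
    exact Continuous.matrix_elem (by fun_prop) i i
  have h3 := h2.mem_of_tendsto hlim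
    (Eventually.of_forall fun k => (hA k).sum_norm_diag_le hB.eigenvectorUnitary)
  simp only [Set.mem_ofPred_eq, conjTranspose_mul_mul_eigenvectorUnitary] at h3
  rw [traceNorm_eq_sum_abs_eigenvalues B hB]
  simpa using h3

/-- The positive semidefinite matrices span. -/
theorem span_posSemidef : Submodule.span ℂ {A : Matrix n n ℂ | A.PosSemidef} = ⊤ := by
  have hherm : ∀ A : Matrix n n ℂ, A.IsHermitian →
      A ∈ Submodule.span ℂ {A : Matrix n n ℂ | A.PosSemidef} := by
    intro A hA
    obtain ⟨P, Q, hP, hQ, rfl, -⟩ := isTraceBounded_traceNorm hA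
    exact Submodule.sub_mem _ (Submodule.subset_span hP) (Submodule.subset_span hQ)
  refine Submodule.eq_top_iff'.2 fun A => ?_
  have hA : A = (1 / 2 : ℂ) • (A + Aᴴ) + (-Complex.I / 2) • (Complex.I • (A - Aᴴ)) := by
    rw [smul_smul, show -Complex.I / 2 * Complex.I = 1 / 2 by
      rw [div_mul_eq_mul_div, neg_mul, Complex.I_mul_I]; norm_num]
    rw [← smul_add, add_add_sub_cancel, ← two_smul ℂ A, smul_smul]
    norm_num
  rw [hA]
  refine Submodule.add_mem _ (Submodule.smul_mem _ _ (hherm _ ?_))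
    (Submodule.smul_mem _ _ (hherm _ ?_))
  · simp [Matrix.IsHermitian, add_comm]
  · simp [Matrix.IsHermitian, Matrix.conjTranspose_smul, ← smul_neg]

end TraceBound

/-! ### Superoperators with an auxiliary space -/

section Tensor

variable {n m a b : Type}

@[simp]
theorem tensorId_zero (a : Type) : (0 : Superop n).tensorId a = 0 := rfl

theorem tensorId_comp (E F : Superop n) (a : Type) :
    Superop.tensorId (E ∘ₗ F) a = E.tensorId a ∘ₗ F.tensorId a := rfl

theorem tensorId_add (E F : Superop n) (a : Type) :
    (E + F).tensorId a = E.tensorId a + F.tensorId a := rfl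

theorem tensorId_sub (E F : Superop n) (a : Type) :
    (E - F).tensorId a = E.tensorId a - F.tensorId a := rfl

theorem tensorId_smul (c : ℂ) (E : Superop n) (a : Type) :
    (c • E).tensorId a = c • E.tensorId a := rfl

theorem tensorId_iterate (E : Superop n) (a : Type) (k : ℕ) :
    Superop.tensorId (E ^ k) a = E.tensorId a ^ k := by
  induction k with
  | zero => rfl
  | succ k ih => rw [pow_succ, pow_succ, ← ih]; rfl

theorem tensorId_sum {ι : Type} (s : Finset ι) (E : ι → Superop n) (a : Type) :
    (∑ i ∈ s, E i).tensorId a = ∑ i ∈ s, (E i).tensorId a := by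
  classical
  induction s using Finset.induction_on with
  | empty => simp
  | insert i s hi ih => rw [Finset.sum_insert hi, Finset.sum_insert hi, tensorId_add, ih]

theorem tensorId_submatrix (E : Superop n) (e : a ≃ b) (ρ : Matrix (n × b) (n × b) ℂ) :
    E.tensorId a (ρ.submatrix (Equiv.prodCongr (.refl n) e) (Equiv.prodCongr (.refl n) e)) =
      (E.tensorId b ρ).submatrix (Equiv.prodCongr (.refl n) e) (Equiv.prodCongr (.refl n) e) :=
  rfl

/-- The identification of the register, the remaining variables and an auxiliary space. -/
def Register.splitAux (q : Register n) (a : Type) : n × a ≃ q.carrier × (q.rest × a) :=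
  (Equiv.prodCongr q.split (.refl a)).trans (Equiv.prodAssoc _ _ _)

/-- A superoperator on a register, tensored with the identity twice, is the original
superoperator with the remaining variables as part of the auxiliary space. -/
theorem tensorId_liftSuperop (q : Register n) (E : Superop q.carrier) (a : Type)
    (ρ : Matrix (n × a) (n × a) ℂ) :
    (q.liftSuperop E).tensorId a ρ =
      (E.tensorId (q.rest × a) (ρ.submatrix (q.splitAux a).symm (q.splitAux a).symm)).submatrix
        (q.splitAux a) (q.splitAux a) := rfl

theorem liftSuperop_apply (q : Register n) (E : Superop q.carrier) (ρ : Matrix n n ℂ) :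
    q.liftSuperop E ρ =
      (E.tensorId q.rest (ρ.submatrix q.split.symm q.split.symm)).submatrix q.split q.split := rfl

/-- The partial trace over the auxiliary space. -/
def partialTrace [Fintype a] (ρ : Matrix (n × a) (n × a) ℂ) : Matrix n n ℂ :=
  ∑ x, ρ.submatrix (fun i => (i, x)) (fun j => (j, x))

theorem posSemidef_partialTrace [Fintype a] {ρ : Matrix (n × a) (n × a) ℂ} (hρ : ρ.PosSemidef) :
    (partialTrace ρ).PosSemidef :=
  Matrix.posSemidef_sum _ fun _ _ => hρ.submatrix _

theorem partialTrace_tensorId [Fintype a] (E : Superop n) (ρ : Matrix (n × a) (n × a) ℂ) :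
    partialTrace (E.tensorId a ρ) = E (partialTrace ρ) := by
  rw [partialTrace, partialTrace, map_sum E]
  rfl

variable [Fintype n]

theorem sandwich_apply (A ρ : Matrix n n ℂ) : sandwich A ρ = A * ρ * Aᴴ := rfl

theorem tensorId_sandwich [Fintype a] [DecidableEq a] (A : Matrix n n ℂ) :
    (sandwich A).tensorId a = sandwich (A ⊗ₖ (1 : Matrix a a ℂ)) := by
  refine LinearMap.ext fun ρ => ?_
  ext ⟨i, x⟩ ⟨j, y⟩
  simp [Superop.tensorId, sandwich_apply, Matrix.mul_apply, Fintype.sum_prod_type,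
    Matrix.one_apply, apply_ite]

theorem sandwich_lift [DecidableEq n] (q : Register n) (A : Matrix q.carrier q.carrier ℂ) :
    sandwich (q.lift A) = q.liftSuperop (sandwich A) := by
  refine LinearMap.ext fun ρ => ?_
  rw [liftSuperop_apply, tensorId_sandwich, sandwich_apply, sandwich_apply, Register.lift,
    Matrix.conjTranspose_submatrix]
  have : ρ = (ρ.submatrix q.split.symm q.split.symm).submatrix q.split q.split := by simp
  conv_lhs => rw [this]
  rw [Matrix.submatrix_mul_equiv, Matrix.submatrix_mul_equiv]

theorem trace_partialTrace [Fintype a] (ρ : Matrix (n × a) (n × a) ℂ) :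
    (partialTrace ρ).trace = ρ.trace := by
  simp only [partialTrace, Matrix.trace, Matrix.diag_apply, Fintype.sum_prod_type]
  simp only [Matrix.sum_apply, Matrix.submatrix_apply]

theorem trace_tensorId [Fintype a] (E : Superop n) (ρ : Matrix (n × a) (n × a) ℂ) :
    (E.tensorId a ρ).trace = (E (partialTrace ρ)).trace := by
  rw [← partialTrace_tensorId, trace_partialTrace]

end Tensor

/-! ### Admissible superoperators -/

section QuantumOp

variable {n a : Type}

/-- The auxiliary space may be any finite type, not only some `Fin k`. -/
theorem Superop.IsCompletelyPositive.posSemidef_tensorId [Fintype a] {E : Superop n}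
    (hE : E.IsCompletelyPositive) {ρ : Matrix (n × a) (n × a) ℂ} (hρ : ρ.PosSemidef) :
    (E.tensorId a ρ).PosSemidef := by
  have e := Fintype.equivFin a
  have h := hE _ _ (hρ.submatrix (Equiv.prodCongr (.refl n) e.symm))
  rw [tensorId_submatrix] at h
  exact (Matrix.posSemidef_submatrix_equiv _).1 h

theorem Superop.IsCompletelyPositive.add {E F : Superop n} (hE : E.IsCompletelyPositive)
    (hF : F.IsCompletelyPositive) : (E + F).IsCompletelyPositive :=
  fun k ρ hρ => (hE k ρ hρ).add (hF k ρ hρ)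

theorem Superop.IsCompletelyPositive.smul {E : Superop n} (hE : E.IsCompletelyPositive) {r : ℝ}
    (hr : 0 ≤ r) : ((r : ℂ) • E).IsCompletelyPositive :=
  fun k ρ hρ => (hE k ρ hρ).smul (Complex.zero_le_real.2 hr)

theorem Superop.isCompletelyPositive_zero : (0 : Superop n).IsCompletelyPositive :=
  fun _ _ _ => .zero

theorem Superop.isCompletelyPositive_sum {ι : Type} (s : Finset ι) {E : ι → Superop n}
    (hE : ∀ i, (E i).IsCompletelyPositive) : (∑ i ∈ s, E i).IsCompletelyPositive := by
  intro k ρ hρ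
  rw [tensorId_sum, LinearMap.sum_apply]
  exact Matrix.posSemidef_sum _ fun i _ => hE i k ρ hρ

theorem Superop.IsCompletelyPositive.comp {E F : Superop n} (hE : E.IsCompletelyPositive)
    (hF : F.IsCompletelyPositive) : Superop.IsCompletelyPositive (E ∘ₗ F) :=
  fun k ρ hρ => hE k _ (hF k ρ hρ)

theorem Register.conjTranspose_lift [DecidableEq n] (q : Register n)
    (A : Matrix q.carrier q.carrier ℂ) : (q.lift A)ᴴ = q.lift Aᴴ := by
  rw [Register.lift, Matrix.conjTranspose_submatrix, Matrix.conjTranspose_kronecker,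
    Matrix.conjTranspose_one, Register.lift]

theorem Register.lift_one [DecidableEq n] (q : Register n) : q.lift 1 = 1 := by
  rw [Register.lift, Matrix.one_kronecker_one, Matrix.submatrix_one_equiv]

theorem Register.lift_sum {ι : Type} (q : Register n) (s : Finset ι)
    (A : ι → Matrix q.carrier q.carrier ℂ) : q.lift (∑ i ∈ s, A i) = ∑ i ∈ s, q.lift (A i) := by
  ext i j
  simp [Register.lift, Matrix.sum_apply, Finset.sum_mul]

theorem Superop.IsCompletelyPositive.posSemidef_apply {E : Superop n}
    (hE : E.IsCompletelyPositive) {ρ : Matrix n n ℂ} (hρ : ρ.PosSemidef) :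
    (E ρ).PosSemidef :=
  (hE.posSemidef_tensorId (a := Unit) (hρ.submatrix Prod.fst)).submatrix fun i => (i, ())

variable [Fintype n]

/-- The property of being admissible: completely positive and trace-non-increasing. -/
structure Superop.IsQuantumOp (E : Superop n) : Prop where
  completelyPositive : E.IsCompletelyPositive
  traceNonincreasing : E.IsTraceNonincreasing

namespace Superop

theorem isCompletelyPositive_sandwich (A : Matrix n n ℂ) :
    (sandwich A).IsCompletelyPositive := fun k ρ hρ => by
  rw [tensorId_sandwich]
  exact hρ.mul_mul_conjTranspose_same _

theorem IsQuantumOp.comp {E F : Superop n} (hE : E.IsQuantumOp) (hF : F.IsQuantumOp) :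
    Superop.IsQuantumOp (E ∘ₗ F) where
  completelyPositive := hE.1.comp hF.1
  traceNonincreasing ρ hρ :=
    (hE.2 _ (hF.1.posSemidef_apply hρ)).trans (hF.2 ρ hρ)

theorem isQuantumOp_id : Superop.IsQuantumOp (LinearMap.id : Superop n) :=
  ⟨fun _ _ h => h, fun _ _ => le_rfl⟩

theorem IsQuantumOp.pow {E : Superop n} (hE : E.IsQuantumOp) (k : ℕ) :
    Superop.IsQuantumOp (E ^ k) := by
  induction k with
  | zero => exact isQuantumOp_id
  | succ k ih => rw [pow_succ]; exact ih.comp hE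

theorem IsQuantumOp.tensorId_trace_le [Fintype a] {E : Superop n} (hE : E.IsQuantumOp)
    {ρ : Matrix (n × a) (n × a) ℂ} (hρ : ρ.PosSemidef) :
    (E.tensorId a ρ).trace.re ≤ ρ.trace.re := by
  rw [trace_tensorId, ← trace_partialTrace ρ]
  exact hE.2 _ (posSemidef_partialTrace hρ)

theorem IsQuantumOp.isTraceBounded_tensorId [Fintype a] {E : Superop n} (hE : E.IsQuantumOp)
    {A : Matrix (n × a) (n × a) ℂ} {c : ℝ} (hA : IsTraceBounded A c) :
    IsTraceBounded (E.tensorId a A) c :=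
  hA.map (fun _ h => hE.1.posSemidef_tensorId h) fun _ h => hE.tensorId_trace_le h

theorem IsQuantumOp.convexCombination {E F : Superop n} (hE : E.IsQuantumOp)
    (hF : F.IsQuantumOp) (p : unitInterval) :
    (((1 - (p : ℝ) : ℝ) : ℂ) • E + ((p : ℝ) : ℂ) • F).IsQuantumOp where
  completelyPositive :=
    (hE.1.smul (sub_nonneg.2 p.2.2)).add (hF.1.smul p.2.1)
  traceNonincreasing ρ hρ := by
    simp only [LinearMap.add_apply, LinearMap.smul_apply, Matrix.trace_add, Matrix.trace_smul,
      Complex.add_re, smul_eq_mul, Complex.re_ofReal_mul]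
    nlinarith [hE.2 ρ hρ, hF.2 ρ hρ, p.2.1, p.2.2]

theorem trace_sandwich (A ρ : Matrix n n ℂ) : (sandwich A ρ).trace = (Aᴴ * A * ρ).trace := by
  rw [sandwich_apply, Matrix.trace_mul_comm, Matrix.mul_assoc]

theorem isQuantumOp_sandwich_unitary [DecidableEq n] (U : Matrix.unitaryGroup n ℂ) :
    (sandwich (U : Matrix n n ℂ)).IsQuantumOp where
  completelyPositive := isCompletelyPositive_sandwich _
  traceNonincreasing ρ _ := by
    have : (U : Matrix n n ℂ)ᴴ * (U : Matrix n n ℂ) = 1 := Matrix.mem_unitaryGroup_iff'.1 U.2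
    rw [trace_sandwich, this, Matrix.one_mul]

theorem IsQuantumOp.liftSuperop (q : Register n) {E : Superop q.carrier} (hE : E.IsQuantumOp) :
    (q.liftSuperop E).IsQuantumOp where
  completelyPositive k ρ hρ := by
    rw [tensorId_liftSuperop]
    exact (hE.1.posSemidef_tensorId (hρ.submatrix _)).submatrix _
  traceNonincreasing ρ hρ := by
    rw [liftSuperop_apply, trace_submatrix_equiv, ← trace_submatrix_equiv ρ q.split.symm]
    exact hE.tensorId_trace_le (hρ.submatrix _)

end Superop

theorem QuantumOp.isQuantumOp (Φ : QuantumOp n) : Φ.toSuperop.IsQuantumOp :=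
  ⟨Φ.completelyPositive, Φ.traceNonincreasing⟩

theorem Register.lift_mul [DecidableEq n] (q : Register n) (A B : Matrix q.carrier q.carrier ℂ) :
    q.lift A * q.lift B = q.lift (A * B) := by
  rw [Register.lift, Register.lift, Matrix.submatrix_mul_equiv, ← Matrix.mul_kronecker_mul,
    Matrix.one_mul, Register.lift]

theorem isQuantumOp_initSem [DecidableEq n] (q : Register n) (k : q.carrier) :
    (initSem q k).IsQuantumOp where
  completelyPositive :=
    Superop.isCompletelyPositive_sum _ fun _ => Superop.isCompletelyPositive_sandwich _
  traceNonincreasing ρ _ := by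
    have h : ∑ j, (Matrix.single j j (1 : ℂ) : Matrix q.carrier q.carrier ℂ) = 1 := by
      ext i j
      simp only [Matrix.sum_apply, Matrix.single_apply, Matrix.one_apply]
      by_cases hij : i = j <;> simp [hij, ite_and]
    rw [initSem, LinearMap.sum_apply, Matrix.trace_sum]
    simp only [Superop.trace_sandwich]
    rw [← Matrix.trace_sum, ← Finset.sum_mul]
    simp only [Register.conjTranspose_lift, Register.lift_mul]
    rw [← Register.lift_sum]
    simp [h, Register.lift_one]

theorem isCompletelyPositive_branch (q : Register n) {m : ℕ} (M : Measurement q.carrier m)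
    (i : Fin m) : (branch q M i).IsCompletelyPositive :=
  Superop.isCompletelyPositive_sandwich _

theorem trace_branch_add [DecidableEq n] (q : Register n) (M : Measurement q.carrier 2)
    (ρ : Matrix n n ℂ) : (branch q M 0 ρ).trace + (branch q M 1 ρ).trace = ρ.trace := by
  rw [branch, branch, Superop.trace_sandwich, Superop.trace_sandwich, ← Matrix.trace_add,
    ← Matrix.add_mul]
  have := M.complete
  rw [Fin.sum_univ_two] at this
  rw [Register.conjTranspose_lift, Register.conjTranspose_lift, Register.lift_mul,
    Register.lift_mul, show ∀ A B, q.lift A + q.lift B = q.lift (A + B) from fun A B => by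
      simpa using (q.lift_sum Finset.univ ![A, B]).symm, this, Register.lift_one, Matrix.one_mul]

theorem isQuantumOp_branch_one [DecidableEq n] (q : Register n) (M : Measurement q.carrier 2) :
    (branch q M 1).IsQuantumOp where
  completelyPositive := isCompletelyPositive_branch q M 1
  traceNonincreasing ρ hρ := by
    have h0 := trace_re_nonneg ((isCompletelyPositive_branch q M 0).posSemidef_apply hρ)
    have := congrArg Complex.re (trace_branch_add q M ρ)
    rw [Complex.add_re] at this
    linarith

theorem isQuantumOp_unroll [DecidableEq n] (q : Register n) (M : Measurement q.carrier 2)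
    {F : Superop n} (hF : F.IsQuantumOp) (k : ℕ) : (unroll q M F k).IsQuantumOp := by
  induction k with
  | zero =>
    exact ⟨Superop.isCompletelyPositive_zero, fun ρ hρ => by
      simpa [unroll] using trace_re_nonneg hρ⟩
  | succ k ih =>
    refine ⟨(isCompletelyPositive_branch q M 0).add
      (ih.1.comp (hF.1.comp (isCompletelyPositive_branch q M 1))), fun ρ hρ => ?_⟩
    have h1 := (isCompletelyPositive_branch q M 1).posSemidef_apply hρ
    have h2 := ih.2 _ (hF.1.posSemidef_apply h1)
    have h3 := hF.2 _ h1
    have h4 := congrArg Complex.re (trace_branch_add q M ρ)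
    rw [Complex.add_re] at h4
    simp only [unroll, LinearMap.add_apply, LinearMap.comp_apply, Matrix.trace_add, Complex.add_re]
    linarith

end QuantumOp

/-! ### Error bounds in the diamond norm -/

section Error

variable {n a : Type} [Fintype n]

/-- The superoperators `E` and `F` differ by at most `ε` in the diamond norm. The bound is stated
for inputs of arbitrary trace, to which it scales, and `2` accounts for the factor `1 / 2` in the
trace distance. -/
def ErrorLE (E F : Superop n) (ε : ℝ) : Prop :=
  ∀ (k : ℕ) (ρ : Matrix (n × Fin k) (n × Fin k) ℂ), ρ.PosSemidef →
    IsTraceBounded ((E - F).tensorId (Fin k) ρ) (2 * ε * ρ.trace.re)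

/-- The auxiliary space may be any finite type, not only some `Fin k`. -/
theorem ErrorLE.isTraceBounded [Fintype a] {E F : Superop n} {ε : ℝ} (h : ErrorLE E F ε)
    {ρ : Matrix (n × a) (n × a) ℂ} (hρ : ρ.PosSemidef) :
    IsTraceBounded ((E - F).tensorId a ρ) (2 * ε * ρ.trace.re) := by
  have e := Fintype.equivFin a
  have h1 := h _ _ (hρ.submatrix (Equiv.prodCongr (.refl n) e.symm))
  rw [tensorId_submatrix, trace_submatrix_equiv] at h1
  simpa [Prod.map_comp_map] using h1.submatrix_equiv (Equiv.prodCongr (.refl n) e)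

theorem ErrorLE.qDiamondDist_le [DecidableEq n] {E F : Superop n} {ε : ℝ} (h : ErrorLE E F ε)
    (Q : Matrix n n ℂ) (lam : ℝ) : qDiamondDist E F Q lam ≤ ENNReal.ofReal ε := by
  refine iSup_le fun k => iSup_le fun ρ => iSup_le fun hρ => ENNReal.ofReal_le_ofReal ?_
  have h1 := (isTraceBounded_iff.1 (h k ρ hρ.1)).2
  rw [hρ.2.1, Complex.one_re, mul_one, tensorId_sub, LinearMap.sub_apply] at h1
  rw [traceDist]
  linarith

theorem isTraceBounded_tensorId_sub [Fintype a] {E F : Superop n} (hE : E.IsQuantumOp)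
    (hF : F.IsQuantumOp) {ρ : Matrix (n × a) (n × a) ℂ} (hρ : ρ.PosSemidef) :
    IsTraceBounded (E.tensorId a ρ - F.tensorId a ρ) (2 * ρ.trace.re) :=
  ⟨_, _, hE.1.posSemidef_tensorId hρ, hF.1.posSemidef_tensorId hρ, rfl, by
    linarith [hE.tensorId_trace_le hρ, hF.tensorId_trace_le hρ]⟩

/-- In particular the distance is finite, so that its real value is not a junk value. -/
theorem diamondDist_le_one [DecidableEq n] {E F : Superop n} (hE : E.IsQuantumOp)
    (hF : F.IsQuantumOp) : diamondDist E F ≤ 1 := by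
  refine iSup_le fun k => iSup_le fun ρ => iSup_le fun hρ => ?_
  rw [← ENNReal.ofReal_one]
  refine ENNReal.ofReal_le_ofReal ?_
  have h1 := (isTraceBounded_iff.1 (isTraceBounded_tensorId_sub hE hF hρ.1)).2
  rw [hρ.2, Complex.one_re, mul_one] at h1
  rw [traceDist]
  linarith

/-- The diamond distance bounds the error on inputs of arbitrary trace. -/
theorem errorLE_diamondDist [DecidableEq n] {E F : Superop n} (hE : E.IsQuantumOp)
    (hF : F.IsQuantumOp) : ErrorLE E F (diamondDist E F).toReal := by
  intro k ρ hρ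
  rcases (trace_re_nonneg hρ).eq_or_lt with ht | ht
  · have h0 : ρ = 0 := by
      ext i j
      have := norm_apply_le_trace hρ i j
      rw [← ht] at this
      simpa using this
    rw [h0, map_zero]
    simpa using isTraceBounded_zero
  · -- normalise the input to a density operator
    set t := ρ.trace.re with htdef
    have htr : ρ.trace = (t : ℂ) := by
      apply Complex.ext
      · simp [htdef]
      · simpa using (Complex.nonneg_iff.1 hρ.trace_nonneg).2.symm
    set σ := ((t⁻¹ : ℝ) : ℂ) • ρ with hσ
    have hσp : σ.PosSemidef := hρ.smul (Complex.zero_le_real.2 (inv_nonneg.2 ht.le))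
    have hσt : σ.trace = 1 := by
      rw [hσ, Matrix.trace_smul, htr, smul_eq_mul, ← Complex.ofReal_mul, inv_mul_cancel₀ ht.ne',
        Complex.ofReal_one]
    have hρσ : ρ = (t : ℂ) • σ := by
      rw [hσ, smul_smul, ← Complex.ofReal_mul, mul_inv_cancel₀ ht.ne', Complex.ofReal_one, one_smul]
    have hne : diamondDist E F ≠ ⊤ :=
      ((diamondDist_le_one hE hF).trans_lt ENNReal.one_lt_top).ne
    have h1 : ENNReal.ofReal (traceDist (E.tensorId (Fin k) σ) (F.tensorId (Fin k) σ)) ≤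
        diamondDist E F :=
      le_iSup_of_le k (le_iSup_of_le σ (le_iSup_of_le ⟨hσp, hσt⟩ le_rfl))
    have h2 := (ENNReal.ofReal_le_iff_le_toReal hne).1 h1
    have h3 : IsTraceBounded ((E - F).tensorId (Fin k) σ) (2 * (diamondDist E F).toReal) := by
      refine isTraceBounded_iff.2 ⟨(isTraceBounded_tensorId_sub hE hF hσp).isHermitian, ?_⟩
      rw [traceDist] at h2
      rw [tensorId_sub, LinearMap.sub_apply]
      linarith
    have h4 := h3.smul ht.le
    rw [← map_smul, ← hρσ] at h4
    exact h4.mono (by linarith)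

theorem ErrorLE.smul {E F : Superop n} {ε : ℝ} (h : ErrorLE E F ε) {r : ℝ} (hr : 0 ≤ r)
    {E' F' : Superop n} (hEF : E' - F' = (r : ℂ) • (E - F)) : ErrorLE E' F' (r * ε) := by
  intro k ρ hρ
  rw [hEF, tensorId_smul, LinearMap.smul_apply]
  exact ((h k ρ hρ).smul hr).mono (by linarith)

theorem ErrorLE.liftSuperop (q : Register n) {E F : Superop q.carrier} {ε : ℝ}
    (h : ErrorLE E F ε) : ErrorLE (q.liftSuperop E) (q.liftSuperop F) ε := by
  intro k ρ hρ
  have h1 := (h.isTraceBounded (hρ.submatrix (q.splitAux (Fin k)).symm)).submatrix_equiv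
    (q.splitAux (Fin k))
  rw [trace_submatrix_equiv] at h1
  exact h1

/-- Errors of consecutive operations add up. -/
theorem ErrorLE.comp {E E' F F' : Superop n} {ε δ : ℝ} (h₂ : ErrorLE E' F' δ)
    (h₁ : ErrorLE E F ε) (hE' : E'.IsQuantumOp) (hF : F.IsQuantumOp) (hδ : 0 ≤ δ) :
    ErrorLE (E' ∘ₗ E) (F' ∘ₗ F) (ε + δ) := by
  intro k ρ hρ
  have h : E' ∘ₗ E - F' ∘ₗ F = E' ∘ₗ (E - F) + (E' - F') ∘ₗ F := by
    rw [LinearMap.comp_sub, LinearMap.sub_comp]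
    abel
  rw [h, tensorId_add, LinearMap.add_apply, tensorId_comp, tensorId_comp, LinearMap.comp_apply,
    LinearMap.comp_apply]
  refine ((hE'.isTraceBounded_tensorId (h₁ k ρ hρ)).add
    (h₂ k _ (hF.1.posSemidef_tensorId hρ))).mono ?_
  nlinarith [hF.tensorId_trace_le hρ]

theorem ErrorLE.comp_right {E F G : Superop n} {ε : ℝ} (h : ErrorLE E F ε) (hG : G.IsQuantumOp)
    (hε : 0 ≤ ε) : ErrorLE (E ∘ₗ G) (F ∘ₗ G) ε := by
  intro k ρ hρ
  refine (h k _ (hG.1.posSemidef_tensorId hρ)).mono ?_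
  nlinarith [hG.tensorId_trace_le hρ]

/-- The semantics of a noisy gate is an admissible superoperator. -/
theorem isQuantumOp_noisyUnitary [DecidableEq n] (q : Register n)
    (U : Matrix.unitaryGroup q.carrier ℂ) (p : unitInterval) (Φ : QuantumOp q.carrier) :
    (NoisyProg.unitary q U p Φ).sem.IsQuantumOp := by
  rw [NoisyProg.sem, sandwich_lift]
  exact ((Superop.isQuantumOp_sandwich_unitary U).liftSuperop q).convexCombination
    (Φ.isQuantumOp.liftSuperop q) p

theorem isQuantumOp_unitary [DecidableEq n] (q : Register n)
    (U : Matrix.unitaryGroup q.carrier ℂ) : (Prog.unitary q U).sem.IsQuantumOp := by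
  rw [Prog.sem, sandwich_lift]
  exact (Superop.isQuantumOp_sandwich_unitary U).liftSuperop q

theorem errorLE_noisyUnitary [DecidableEq n] (q : Register n)
    (U : Matrix.unitaryGroup q.carrier ℂ) (p : unitInterval) (Φ : QuantumOp q.carrier) :
    ErrorLE (NoisyProg.unitary q U p Φ).sem (Prog.unitary q U).sem (unitaryError U p Φ) := by
  have h := (errorLE_diamondDist Φ.isQuantumOp
    (Superop.isQuantumOp_sandwich_unitary U)).liftSuperop q
  refine h.smul p.2.1 ?_
  rw [NoisyProg.sem, Prog.sem, sandwich_lift, Complex.ofReal_sub, Complex.ofReal_one]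
  module

end Error

/-! ### Loops as limits of their unrollings -/

section Loop

open Filter Topology

theorem unroll_succ {n : Type} [Fintype n] (q : Register n) (M : Measurement q.carrier 2)
    (F : Superop n) (k : ℕ) :
    unroll q M F (k + 1) = branch q M 0 + unroll q M F k ∘ₗ F ∘ₗ branch q M 1 := rfl

theorem unroll_eq_sum {n : Type} [Fintype n] (q : Register n) (M : Measurement q.carrier 2)
    (F : Superop n) (k : ℕ) (ρ : Matrix n n ℂ) :
    unroll q M F k ρ = ∑ j ∈ Finset.range k, branch q M 0 (((F ∘ₗ branch q M 1) ^ j) ρ) := by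
  induction k generalizing ρ with
  | zero => rfl
  | succ k ih =>
    rw [unroll_succ, LinearMap.add_apply, LinearMap.comp_apply, LinearMap.comp_apply, ih,
      Finset.sum_range_succ', add_comm]
    rfl

variable {n a : Type} [Fintype n] [DecidableEq n]

section Limit

variable (q : Register n) (M : Measurement q.carrier 2) {F : Superop n}

/-- The (unnormalised) state in which the loop is left after `j` executions of the body. -/
theorem posSemidef_exit (hF : F.IsQuantumOp) {ρ : Matrix n n ℂ} (hρ : ρ.PosSemidef) (j : ℕ) :
    (branch q M 0 (((F ∘ₗ branch q M 1) ^ j) ρ)).PosSemidef :=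
  (isCompletelyPositive_branch q M 0).posSemidef_apply
    (((hF.comp (isQuantumOp_branch_one q M)).pow j).1.posSemidef_apply hρ)

/-- On a positive semidefinite input the unrollings converge: they are the partial sums of a
series of positive semidefinite matrices whose traces sum to at most the trace of the input. -/
theorem exists_tendsto_unroll_of_posSemidef (hF : F.IsQuantumOp) {ρ : Matrix n n ℂ}
    (hρ : ρ.PosSemidef) : ∃ L, Tendsto (fun k => unroll q M F k ρ) atTop (𝓝 L) := by
  have hD := posSemidef_exit q M hF hρ
  have htr : Summable fun j => (branch q M 0 (((F ∘ₗ branch q M 1) ^ j) ρ)).trace.re := by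
    refine summable_of_sum_range_le (c := ρ.trace.re) (fun j => trace_re_nonneg (hD j)) fun k => ?_
    rw [← Complex.re_sum, ← Matrix.trace_sum, ← unroll_eq_sum]
    exact (isQuantumOp_unroll q M hF k).2 ρ hρ
  refine ⟨fun i j => ∑' k, branch q M 0 (((F ∘ₗ branch q M 1) ^ k) ρ) i j,
    tendsto_pi_nhds.2 fun i => tendsto_pi_nhds.2 fun j => ?_⟩
  have h := (Summable.of_norm_bounded htr
    fun k => norm_apply_le_trace (hD k) i j).hasSum.tendsto_sum_nat
  simpa only [unroll_eq_sum, Matrix.sum_apply] using h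

theorem exists_tendsto_unroll (hF : F.IsQuantumOp) (ρ : Matrix n n ℂ) :
    ∃ L, Tendsto (fun k => unroll q M F k ρ) atTop (𝓝 L) := by
  have hρ : ρ ∈ Submodule.span ℂ {A : Matrix n n ℂ | A.PosSemidef} :=
    span_posSemidef (n := n) ▸ Submodule.mem_top
  induction hρ using Submodule.span_induction with
  | mem ρ h => exact exists_tendsto_unroll_of_posSemidef q M hF h
  | zero => exact ⟨0, by simp only [map_zero]; exact tendsto_const_nhds⟩
  | add ρ σ _ _ h₁ h₂ =>
    obtain ⟨L₁, h₁⟩ := h₁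
    obtain ⟨L₂, h₂⟩ := h₂
    exact ⟨L₁ + L₂, by simpa only [map_add] using h₁.add h₂⟩
  | smul c ρ _ h =>
    obtain ⟨L, h⟩ := h
    exact ⟨c • L, by simpa only [map_smul] using h.const_smul c⟩

theorem unroll_monotone (hF : F.IsQuantumOp) {ρ : Matrix n n ℂ} (hρ : ρ.PosSemidef) :
    Monotone fun k => unroll q M F k ρ := by
  refine monotone_nat_of_le_succ fun k => ?_
  rw [Matrix.le_iff, unroll_eq_sum, unroll_eq_sum, Finset.sum_range_succ, add_sub_cancel_left]
  exact posSemidef_exit q M hF hρ k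

/-- The limit of the unrollings is their least upper bound, so it is the semantics of the loop. -/
theorem tendsto_unroll (hF : F.IsQuantumOp) (ρ : Matrix n n ℂ) :
    Tendsto (fun k => unroll q M F k ρ) atTop (𝓝 (loopSem q M F ρ)) := by
  choose g hg using exists_tendsto_unroll q M hF
  set E : Superop n := linearMapOfTendsto g (unroll q M F) (tendsto_pi_nhds.2 hg) with hE
  have hlub : ∀ ρ : Matrix n n ℂ, ρ.PosSemidef →
      IsLUB (Set.range fun k => unroll q M F k ρ) (E ρ) := by
    intro ρ hρ
    have hmono := unroll_monotone q M hF hρ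
    constructor
    · rintro _ ⟨k, rfl⟩
      refine isClosed_posSemidef.mem_of_tendsto ((hg ρ).sub_const (unroll q M F k ρ)) ?_
      filter_upwards [eventually_ge_atTop k] with l hl using hmono hl
    · intro C hC
      refine isClosed_posSemidef.mem_of_tendsto ((hg ρ).const_sub C) ?_
      exact Eventually.of_forall fun k => hC ⟨k, rfl⟩
  have hex : ∃ E : Superop n, ∀ ρ : Matrix n n ℂ, ρ.PosSemidef →
      IsLUB (Set.range fun k => unroll q M F k ρ) (E ρ) := ⟨E, hlub⟩
  have hloop : loopSem q M F = E := by
    rw [loopSem, dif_pos hex]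
    refine LinearMap.ext_on_range
      (v := fun A : {A : Matrix n n ℂ | A.PosSemidef} => (A : Matrix n n ℂ)) ?_ ?_
    · rw [Subtype.range_coe]; exact span_posSemidef
    · exact fun A => (hex.choose_spec A A.2).unique (hlub A A.2)
  rw [hloop]
  exact hg ρ

theorem tendsto_tensorId_unroll (hF : F.IsQuantumOp) (ρ : Matrix (n × a) (n × a) ℂ) :
    Tendsto (fun k => (unroll q M F k).tensorId a ρ) atTop (𝓝 ((loopSem q M F).tensorId a ρ)) :=
  tendsto_pi_nhds.2 fun x => tendsto_pi_nhds.2 fun y =>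
    tendsto_pi_nhds.1 (tendsto_pi_nhds.1 (tendsto_unroll q M hF _) x.1) y.1

end Limit

/-! ### Errors in bounded loops -/

/-- If a nonnegative sequence is nonincreasing and shrinks by the factor `α` every `k` steps, then
it sums to at most `k / (1 - α)` times its first term. -/
theorem sum_range_le_of_geometric {t : ℕ → ℝ} {α : ℝ} {k : ℕ} (hα : α < 1)
    (h0 : ∀ j, 0 ≤ t j) (hanti : ∀ j, t (j + 1) ≤ t j) (hk : ∀ j, t (j + k) ≤ α * t j) (N : ℕ) :
    ∑ j ∈ Finset.range N, t j ≤ k / (1 - α) * t 0 := by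
  have h1 : ∑ j ∈ Finset.range k, t j ≤ k * t 0 := by
    refine (Finset.sum_le_card_nsmul _ _ (t 0) fun j _ => ?_).trans (by simp)
    exact antitone_nat_of_succ_le hanti (Nat.zero_le j)
  have h2 : ∑ j ∈ Finset.range N, t j ≤ ∑ j ∈ Finset.range (k + N), t j :=
    Finset.sum_le_sum_of_subset_of_nonneg (Finset.range_mono (Nat.le_add_left _ _))
      fun j _ _ => h0 j
  have h3 : ∑ j ∈ Finset.range N, t (k + j) ≤ α * ∑ j ∈ Finset.range N, t j := by
    rw [Finset.mul_sum]
    exact Finset.sum_le_sum fun j _ => by rw [add_comm]; exact hk j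
  rw [Finset.sum_range_add] at h2
  rw [div_mul_eq_mul_div, le_div_iff₀ (by linarith)]
  linarith

theorem trace_mul_iterate_dual (G : Superop n) (A ρ : Matrix n n ℂ) (k : ℕ) :
    (A * (G ^ k) ρ).trace = (G.dual^[k] A * ρ).trace := by
  induction k generalizing A with
  | zero => simp
  | succ k ih =>
    rw [Function.iterate_succ_apply, ← ih, ← Superop.trace_mul_dual, pow_succ']
    rfl

theorem trace_mul_re_nonneg {A B : Matrix n n ℂ} (hA : A.PosSemidef) (hB : B.PosSemidef) :
    0 ≤ (A * B).trace.re := by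
  obtain ⟨C, rfl⟩ := CStarAlgebra.nonneg_iff_eq_star_mul_self.1 hB.nonneg
  rw [← Matrix.mul_assoc, Matrix.trace_mul_comm, ← Matrix.mul_assoc]
  exact trace_re_nonneg (hA.mul_mul_conjTranspose_same C)

section Bounded

variable (q : Register n) (M : Measurement q.carrier 2) {F F' : Superop n}

/-- In a bounded loop the probabilities of entering the body in the successive rounds have a sum of
at most `k / (1 - α)`. -/
theorem sum_enter_le [Fintype a] (hF : F.IsQuantumOp) {α : ℝ} {k : ℕ} (hα : α < 1)
    (hb : (Superop.dual (F ∘ₗ branch q M 1))^[k] ((q.lift (M.op 1))ᴴ * q.lift (M.op 1)) ≤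
      (α : ℂ) • ((q.lift (M.op 1))ᴴ * q.lift (M.op 1)))
    {ρ : Matrix (n × a) (n × a) ℂ} (hρ : ρ.PosSemidef) (N : ℕ) :
    ∑ j ∈ Finset.range N, (Superop.tensorId (branch q M 1) a
      ((Superop.tensorId (F ∘ₗ branch q M 1) a ^ j) ρ)).trace.re ≤
        k / (1 - α) * ρ.trace.re := by
  set G := F ∘ₗ branch q M 1 with hG
  have hB := isQuantumOp_branch_one q M
  have hGq : Superop.IsQuantumOp G := hF.comp hB
  set σ := partialTrace ρ with hσ
  have hσp : σ.PosSemidef := posSemidef_partialTrace hρ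
  have hGσ : ∀ j, ((G ^ j) σ).PosSemidef := fun j => (hGq.pow j).1.posSemidef_apply hσp
  have heq : ∀ j, (Superop.tensorId (branch q M 1) a ((Superop.tensorId G a ^ j) ρ)).trace.re =
      (branch q M 1 ((G ^ j) σ)).trace.re := fun j => by
    rw [trace_tensorId, ← tensorId_iterate, partialTrace_tensorId]
  have htr : ∀ τ, (branch q M 1 τ).trace =
      (((q.lift (M.op 1))ᴴ * q.lift (M.op 1)) * τ).trace := fun τ => Superop.trace_sandwich _ _
  simp only [heq]
  have hα0 : 0 < 1 - α := by linarith
  refine (sum_range_le_of_geometric hα (fun j => ?_) (fun j => ?_) (fun j => ?_) N).trans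
    (mul_le_mul_of_nonneg_left ?_ (by positivity))
  · exact trace_re_nonneg (hB.1.posSemidef_apply (hGσ j))
  · rw [pow_succ', Module.End.mul_apply]
    exact (hB.2 _ (hGq.1.posSemidef_apply (hGσ j))).trans
      (hF.2 _ (hB.1.posSemidef_apply (hGσ j)))
  · rw [htr, htr, add_comm, pow_add, Module.End.mul_apply, trace_mul_iterate_dual]
    have h := trace_mul_re_nonneg (Matrix.le_iff.1 hb) (hGσ j)
    rw [Matrix.sub_mul, Matrix.trace_sub, Matrix.smul_mul, Matrix.trace_smul, smul_eq_mul,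
      Complex.sub_re, Complex.re_ofReal_mul] at h
    linarith
  · rw [← trace_partialTrace ρ]
    exact hB.2 _ hσp

/-- The error of an unrolling: in each round, the error of the body is weighted with the
probability that the ideal loop enters this round. -/
theorem isTraceBounded_unroll_sub [Fintype a] (hF' : F'.IsQuantumOp) (hF : F.IsQuantumOp) {ε : ℝ}
    (h : ErrorLE F' F ε) (N : ℕ) {ρ : Matrix (n × a) (n × a) ℂ} (hρ : ρ.PosSemidef) :
    IsTraceBounded ((unroll q M F' N).tensorId a ρ - (unroll q M F N).tensorId a ρ)
      (2 * ε * ∑ j ∈ Finset.range N, (Superop.tensorId (branch q M 1) a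
        ((Superop.tensorId (F ∘ₗ branch q M 1) a ^ j) ρ)).trace.re) := by
  induction N generalizing ρ with
  | zero => simpa [unroll] using isTraceBounded_zero
  | succ N ih =>
    have hB := isQuantumOp_branch_one q M
    have h1 := hB.1.posSemidef_tensorId (a := a) hρ
    have h2 := (isQuantumOp_unroll q M hF' N).isTraceBounded_tensorId (h.isTraceBounded h1)
    have h3 := ih (hF.1.posSemidef_tensorId h1)
    have h4 : (unroll q M F' (N + 1)).tensorId a ρ - (unroll q M F (N + 1)).tensorId a ρ =
        (unroll q M F' N).tensorId a ((F' - F).tensorId a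
          (Superop.tensorId (branch q M 1) a ρ)) +
        ((unroll q M F' N).tensorId a (F.tensorId a (Superop.tensorId (branch q M 1) a ρ)) -
          (unroll q M F N).tensorId a (F.tensorId a (Superop.tensorId (branch q M 1) a ρ))) := by
      rw [tensorId_sub, LinearMap.sub_apply, map_sub]
      simp only [unroll, tensorId_add, tensorId_comp, LinearMap.add_apply, LinearMap.comp_apply]
      abel
    rw [h4, Finset.sum_range_succ', mul_add, add_comm (2 * ε * _)]
    exact h2.add h3

/-- A loop that is `(α, k)`-bounded amplifies the error of its body by at most `k / (1 - α)`. -/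
theorem errorLE_loopSem (hF' : F'.IsQuantumOp) (hF : F.IsQuantumOp) {ε : ℝ} (hε : 0 ≤ ε)
    (h : ErrorLE F' F ε) {α : ℝ} {k : ℕ} (hα : α < 1)
    (hb : (Superop.dual (F ∘ₗ branch q M 1))^[k] ((q.lift (M.op 1))ᴴ * q.lift (M.op 1)) ≤
      (α : ℂ) • ((q.lift (M.op 1))ᴴ * q.lift (M.op 1))) :
    ErrorLE (loopSem q M F') (loopSem q M F) (k / (1 - α) * ε) := by
  intro l ρ hρ
  refine IsTraceBounded.of_tendsto (fun N => (isTraceBounded_unroll_sub q M hF' hF h N hρ).mono ?_)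
    ((tendsto_tensorId_unroll q M hF' ρ).sub (tendsto_tensorId_unroll q M hF ρ))
  calc _ ≤ 2 * ε * (k / (1 - α) * ρ.trace.re) :=
        mul_le_mul_of_nonneg_left (sum_enter_le q M hF hα hb hρ N) (by positivity)
    _ = _ := by ring

end Bounded

end Loop

/-! ### One round of the quantum walk -/

section Walk

theorem dual_sandwich {n : Type} [Fintype n] [DecidableEq n] (K A : Matrix n n ℂ) :
    (sandwich K).dual A = Kᴴ * A * K := by
  refine Matrix.ext_iff_trace_mul_right.2 fun ρ => ?_
  rw [← Superop.trace_mul_dual, sandwich_apply, ← Matrix.mul_assoc, Matrix.trace_mul_comm]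
  simp only [Matrix.mul_assoc]

theorem iterate_dual_sandwich {n : Type} [Fintype n] [DecidableEq n] (K A : Matrix n n ℂ)
    (k : ℕ) : (sandwich K).dual^[k] A = (K ^ k)ᴴ * A * K ^ k := by
  induction k with
  | zero => simp
  | succ k ih =>
    rw [Function.iterate_succ_apply', ih, dual_sandwich, pow_succ, Matrix.conjTranspose_mul]
    simp only [Matrix.mul_assoc]

theorem sandwich_mul {n : Type} [Fintype n] (A B : Matrix n n ℂ) :
    sandwich (A * B) = sandwich A ∘ₗ sandwich B := by
  refine LinearMap.ext fun ρ => ?_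
  simp only [LinearMap.comp_apply, sandwich_apply, Matrix.conjTranspose_mul, Matrix.mul_assoc]

theorem star_dotProduct_mulVec_eq_sum_normSq {n : Type} [Fintype n] (B : Matrix n n ℂ)
    (x : n → ℂ) :
    star x ⬝ᵥ ((Bᴴ * B) *ᵥ x) = ((∑ i, Complex.normSq ((B *ᵥ x) i) : ℝ) : ℂ) := by
  rw [← Matrix.mulVec_mulVec, Matrix.dotProduct_mulVec, ← Matrix.star_mulVec, dotProduct,
    Complex.ofReal_sum]
  refine Finset.sum_congr rfl fun i _ => ?_
  rw [Pi.star_apply, RCLike.star_def, mul_comm, Complex.mul_conj]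

variable (n : ℕ) [NeZero n]

theorem lift_coinReg_mulVec (A : Matrix (Fin 2) (Fin 2) ℂ) (x : WalkBasis n → ℂ) (c : Fin 2)
    (i : ZMod n) : ((coinReg n).lift A *ᵥ x) (c, i) = ∑ d, A c d * x (d, i) := by
  simp only [Matrix.mulVec, dotProduct, Fintype.sum_prod_type]
  refine Finset.sum_congr rfl fun d _ => ?_
  rw [Finset.sum_eq_single i]
  · have : (coinReg n).lift A (c, i) (d, i) = A c d * (1 : Matrix (ZMod n) (ZMod n) ℂ) i i := rfl
    rw [this, Matrix.one_apply_eq, mul_one]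
  · intro j _ hj
    have : (coinReg n).lift A (c, i) (d, j) = A c d * (1 : Matrix (ZMod n) (ZMod n) ℂ) i j := rfl
    rw [this, Matrix.one_apply_ne hj.symm, mul_zero, zero_mul]
  · simp

theorem lift_posReg_mulVec (A : Matrix (ZMod n) (ZMod n) ℂ) (x : WalkBasis n → ℂ) (c : Fin 2)
    (i : ZMod n) : ((posReg n).lift A *ᵥ x) (c, i) = ∑ j, A i j * x (c, j) := by
  simp only [Matrix.mulVec, dotProduct, Fintype.sum_prod_type]
  rw [Finset.sum_eq_single c]
  · refine Finset.sum_congr rfl fun j _ => ?_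
    have : (posReg n).lift A (c, i) (c, j) = A i j * (1 : Matrix (Fin 2) (Fin 2) ℂ) c c := rfl
    rw [this, Matrix.one_apply_eq, mul_one]
  · intro d _ hd
    refine Finset.sum_eq_zero fun j _ => ?_
    have : (posReg n).lift A (c, i) (d, j) = A i j * (1 : Matrix (Fin 2) (Fin 2) ℂ) c d := rfl
    rw [this, Matrix.one_apply_ne hd.symm, mul_zero, zero_mul]
  · simp

theorem lift_coinPosReg (A : Matrix (WalkBasis n) (WalkBasis n) ℂ) :
    (coinPosReg n).lift A = A := by
  ext x y
  have : (coinPosReg n).lift A x y = A x y * (1 : Matrix Unit Unit ℂ) () () := rfl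
  rw [this, Matrix.one_apply_eq, mul_one]

theorem shiftMatrix_mulVec (x : WalkBasis n → ℂ) (c : Fin 2) (i : ZMod n) :
    (shiftMatrix n *ᵥ x) (c, i) = if c = 0 then x (0, i + 1) else x (1, i - 1) := by
  simp only [Matrix.mulVec, dotProduct, Fintype.sum_prod_type, shiftMatrix_apply]
  fin_cases c
  · simp [eq_sub_iff_add_eq, eq_comm]
  · simp [← sub_eq_iff_eq_add]

theorem walkMeasurement_op_one :
    (walkMeasurement n).op 1 = Matrix.diagonal fun i : ZMod n => if i = 1 then 0 else 1 := by
  ext i j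
  simp [walkMeasurement, Matrix.sum_apply, Matrix.single_apply, Matrix.diagonal_apply, ite_and]
  grind

theorem lift_walkMeasurement_mulVec (x : WalkBasis n → ℂ) (c : Fin 2) (i : ZMod n) :
    ((posReg n).lift ((walkMeasurement n).op 1) *ᵥ x) (c, i) = if i = 1 then 0 else x (c, i) := by
  have h := lift_posReg_mulVec n ((walkMeasurement n).op 1) x c i
  rw [walkMeasurement_op_one] at h
  refine (congrArg (fun A => ((posReg n).lift A *ᵥ x) (c, i)) (walkMeasurement_op_one n)).trans
    (h.trans ?_)
  simp [Matrix.diagonal_apply]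

/-- The action on amplitudes of the projection onto the positions other than `1`. -/
def maskAmp {R : Type} [Zero R] (x : WalkBasis n → R) : WalkBasis n → R :=
  fun y => if y.2 = 1 then 0 else x y

/-- The action on amplitudes of one round of the walk, up to the factor `√2`: project onto the
positions other than `1`, apply the unnormalised Hadamard matrix, and shift. -/
def stepAmp {R : Type} [Ring R] (x : WalkBasis n → R) : WalkBasis n → R :=
  fun y => if y.1 = 0 then maskAmp n x (0, y.2 + 1) + maskAmp n x (1, y.2 + 1)
    else maskAmp n x (0, y.2 - 1) - maskAmp n x (1, y.2 - 1)

/-- The operator of one round of the walk. -/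
noncomputable def walkOp : Matrix (WalkBasis n) (WalkBasis n) ℂ :=
  (coinPosReg n).lift (shiftMatrix n) *
    ((coinReg n).lift hadamardMatrix * (posReg n).lift ((walkMeasurement n).op 1))

theorem walkOp_mulVec (x : WalkBasis n → ℂ) :
    walkOp n *ᵥ x = ((1 / √2 : ℝ) : ℂ) • stepAmp n x := by
  ext ⟨c, i⟩
  rw [walkOp, lift_coinPosReg, ← Matrix.mulVec_mulVec, ← Matrix.mulVec_mulVec, shiftMatrix_mulVec]
  simp only [lift_coinReg_mulVec, lift_walkMeasurement_mulVec, Fin.sum_univ_two, hadamardMatrix]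
  by_cases hc : c = 0
  · simp [hc, stepAmp, maskAmp, mul_add]
  · simp [hc, stepAmp, maskAmp, mul_add, sub_eq_add_neg]
    split_ifs <;> simp

theorem walkOp_pow_mulVec (k : ℕ) (x : WalkBasis n → ℂ) :
    walkOp n ^ k *ᵥ x = (((1 / √2) ^ k : ℝ) : ℂ) • (stepAmp n)^[k] x := by
  induction k with
  | zero => simp
  | succ k ih =>
    have hs : ∀ (r : ℂ) (y : WalkBasis n → ℂ), stepAmp n (r • y) = r • stepAmp n y := by
      intro r y
      ext z
      simp only [stepAmp, maskAmp, Pi.smul_apply, smul_eq_mul]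
      split_ifs <;> ring
    rw [pow_succ', ← Matrix.mulVec_mulVec, ih, walkOp_mulVec, hs, smul_smul,
      Function.iterate_succ_apply', ← Complex.ofReal_mul, ← pow_succ']

/-- The amplitudes evolve with real coefficients, so real and imaginary parts evolve separately. -/
theorem sum_normSq_maskAmp_iterate (k : ℕ) (x : WalkBasis n → ℂ) :
    ∑ y, Complex.normSq (maskAmp n ((stepAmp n)^[k] x) y) =
      ∑ y, maskAmp n ((stepAmp n)^[k] fun y => (x y).re) y ^ 2 +
        ∑ y, maskAmp n ((stepAmp n)^[k] fun y => (x y).im) y ^ 2 := by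
  have hre : Function.Semiconj (fun (x : WalkBasis n → ℂ) y => (x y).re) (stepAmp n)
      (stepAmp n) := by
    intro x
    ext y
    simp only [stepAmp, maskAmp]
    split_ifs <;> simp
  have him : Function.Semiconj (fun (x : WalkBasis n → ℂ) y => (x y).im) (stepAmp n)
      (stepAmp n) := by
    intro x
    ext y
    simp only [stepAmp, maskAmp]
    split_ifs <;> simp
  rw [← (hre.iterate_right k).eq x, ← (him.iterate_right k).eq x, ← Finset.sum_add_distrib]
  refine Finset.sum_congr rfl fun y _ => ?_
  simp only [maskAmp]
  split_ifs
  · simp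
  · rw [Complex.normSq_apply]; ring

theorem walk_body_sem :
    (Prog.seq (.unitary (coinReg n) hadamard) (.unitary (coinPosReg n) (shift n))).sem ∘ₗ
      branch (posReg n) (walkMeasurement n) 1 = sandwich (walkOp n) := by
  rw [walkOp, sandwich_mul, sandwich_mul]
  rfl

/-! ### The walk on the 6-cycle -/

theorem sum_walkBasis_six (f : WalkBasis 6 → ℝ) :
    ∑ y, f y = f (0, 0) + f (0, 1) + f (0, 2) + f (0, 3) + f (0, 4) + f (0, 5) +
      (f (1, 0) + f (1, 1) + f (1, 2) + f (1, 3) + f (1, 4) + f (1, 5)) := by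
  rw [Fintype.sum_prod_type, Fin.sum_univ_two]
  exact congrArg₂ (· + ·) (Fin.sum_univ_six fun i => f (0, i)) (Fin.sum_univ_six fun i => f (1, i))

theorem maskAmp_six {R : Type} [Ring R] (x : WalkBasis 6 → R) (c : Fin 2) :
    maskAmp 6 x (c, 0) = x (c, 0) ∧ maskAmp 6 x (c, 1) = 0 ∧ maskAmp 6 x (c, 2) = x (c, 2) ∧
    maskAmp 6 x (c, 3) = x (c, 3) ∧ maskAmp 6 x (c, 4) = x (c, 4) ∧
    maskAmp 6 x (c, 5) = x (c, 5) :=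
  ⟨rfl, rfl, rfl, rfl, rfl, rfl⟩

theorem stepAmp_six {R : Type} [Ring R] (x : WalkBasis 6 → R) :
    (stepAmp 6 x (0, 0) = 0 ∧ stepAmp 6 x (0, 1) = x (0, 2) + x (1, 2) ∧
    stepAmp 6 x (0, 2) = x (0, 3) + x (1, 3) ∧ stepAmp 6 x (0, 3) = x (0, 4) + x (1, 4) ∧
    stepAmp 6 x (0, 4) = x (0, 5) + x (1, 5) ∧ stepAmp 6 x (0, 5) = x (0, 0) + x (1, 0)) ∧
    stepAmp 6 x (1, 0) = x (0, 5) - x (1, 5) ∧ stepAmp 6 x (1, 1) = x (0, 0) - x (1, 0) ∧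
    stepAmp 6 x (1, 2) = 0 ∧ stepAmp 6 x (1, 3) = x (0, 2) - x (1, 2) ∧
    stepAmp 6 x (1, 4) = x (0, 3) - x (1, 3) ∧ stepAmp 6 x (1, 5) = x (0, 4) - x (1, 4) :=
  ⟨⟨add_zero 0, rfl, rfl, rfl, rfl, rfl⟩, rfl, rfl, sub_zero 0, rfl, rfl, rfl⟩

/-- In five rounds at least one sixth of the probability is absorbed at position `1`. -/
theorem sum_sq_maskAmp_iterate_five_le (x : WalkBasis 6 → ℝ) :
    ∑ y, maskAmp 6 ((stepAmp 6)^[5] x) y ^ 2 ≤ 32 * (5 / 6) * ∑ y, maskAmp 6 x y ^ 2 := by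
  simp only [sum_walkBasis_six, maskAmp_six, Function.iterate_succ_apply', Function.iterate_zero,
    id_eq, stepAmp_six]
  -- The difference is positive definite. The squares come from its `LDLᵀ` decomposition, which
  -- splits into the even and the odd positions, since every step changes the parity.
  refine sub_nonneg.1 (le_of_le_of_eq (?_ : 0 ≤
    1 / 141 * (47 * x (0, 0) - 3 * x (0, 4) - 33 * x (1, 0) + 15 * x (1, 4)) ^ 2
    + 1 / 141 * (47 * x (0, 2) + 15 * x (0, 4) + 33 * x (1, 2) + 3 * x (1, 4)) ^ 2
    + 16 / 13677 * (97 * x (0, 4) - 15 * x (1, 0) - 75 * x (1, 2)) ^ 2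
    + 80 / 17957901 * (1313 * x (1, 0) - 225 * x (1, 2) + 1455 * x (1, 4)) ^ 2
    + 160 / 27573 * (14 * x (1, 2) - 3 * x (1, 4)) ^ 2
    + 32 / 21 * x (1, 4) ^ 2
    + 2 / 57 * (19 * x (0, 3) + 6 * x (0, 5) + 9 * x (1, 3)) ^ 2
    + 2 / 5529 * (97 * x (0, 5) - 54 * x (1, 3) - 171 * x (1, 5)) ^ 2
    + 32 / 2037 * (7 * x (1, 3) + 6 * x (1, 5)) ^ 2
    + 32 / 21 * x (1, 5) ^ 2) ?_)
  · positivity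
  · ring

/-- The loop of the walk on the 6-cycle is `(5 / 6, 5)`-bounded. -/
theorem isBoundedLoop_walkLoop_six : (walkLoop 6).IsBoundedLoop (5 / 6) 5 := by
  refine ⟨by norm_num, by norm_num, by norm_num, ?_⟩
  have hs := walk_body_sem 6
  refine (congrArg (fun E : Superop (WalkBasis 6) => (Superop.dual E)^[5]
    (((posReg 6).lift ((walkMeasurement 6).op 1))ᴴ * (posReg 6).lift ((walkMeasurement 6).op 1)))
    hs).trans_le ?_
  rw [iterate_dual_sandwich]
  set B := (posReg 6).lift ((walkMeasurement 6).op 1) with hB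
  have h1 : (walkOp 6 ^ 5)ᴴ * (Bᴴ * B) * walkOp 6 ^ 5 =
      (B * walkOp 6 ^ 5)ᴴ * (B * walkOp 6 ^ 5) := by
    rw [Matrix.conjTranspose_mul]
    simp only [Matrix.mul_assoc]
  rw [h1, Matrix.le_iff]
  refine Matrix.PosSemidef.of_dotProduct_mulVec_nonneg ?_ fun x => ?_
  · refine Matrix.IsHermitian.sub ?_ (Matrix.isHermitian_conjTranspose_mul_self _)
    rw [Matrix.IsHermitian, Matrix.conjTranspose_smul,
      (Matrix.isHermitian_conjTranspose_mul_self B).eq, RCLike.star_def, Complex.conj_ofReal]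
  have hBx : ∀ y, B *ᵥ y = maskAmp 6 y := fun y =>
    funext fun z => lift_walkMeasurement_mulVec 6 y z.1 z.2
  have hsq : ((1 / √2) ^ 5 : ℝ) ^ 2 = 1 / 32 := by
    rw [← pow_mul, mul_comm, pow_mul, div_pow, Real.sq_sqrt (by norm_num)]
    norm_num
  rw [Matrix.sub_mulVec, Matrix.smul_mulVec, dotProduct_sub, dotProduct_smul,
    star_dotProduct_mulVec_eq_sum_normSq, star_dotProduct_mulVec_eq_sum_normSq, smul_eq_mul,
    ← Complex.ofReal_mul, ← Complex.ofReal_sub, Complex.zero_le_real, sub_nonneg,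
    ← Matrix.mulVec_mulVec, walkOp_pow_mulVec, Matrix.mulVec_smul, hBx, hBx]
  simp only [Pi.smul_apply, smul_eq_mul, map_mul, Complex.normSq_ofReal, ← pow_two, hsq]
  rw [← Finset.mul_sum, sum_normSq_maskAmp_iterate,
    show (fun y => Complex.normSq (maskAmp 6 x y)) =
      fun y => Complex.normSq (maskAmp 6 ((stepAmp 6)^[0] x) y) from rfl,
    sum_normSq_maskAmp_iterate]
  have hr := sum_sq_maskAmp_iterate_five_le fun y => (x y).re
  have hi := sum_sq_maskAmp_iterate_five_le fun y => (x y).im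
  simp only [Function.iterate_zero, id_eq]
  linarith

/-- The noisy loop on the 6-cycle differs from the ideal one by at most `5 / (1 - 5 / 6) = 30`
times the error of the body. -/
theorem errorLE_walkLoop_six (pH pS : unitInterval) (ΦH : QuantumOp (Fin 2))
    (ΦS : QuantumOp (Fin 2 × ZMod 6)) :
    ErrorLE (noisyWalkLoop 6 pH pS ΦH ΦS).sem (walkLoop 6).sem
      ((30 * (unitaryError hadamard pH ΦH + unitaryError (shift 6) pS ΦS) : ℝ≥0) : ℝ) := by
  have hH := errorLE_noisyUnitary (coinReg 6) hadamard pH ΦH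
  have hS := errorLE_noisyUnitary (coinPosReg 6) (shift 6) pS ΦS
  have hHn := isQuantumOp_noisyUnitary (coinReg 6) hadamard pH ΦH
  have hSn := isQuantumOp_noisyUnitary (coinPosReg 6) (shift 6) pS ΦS
  have hHi := isQuantumOp_unitary (coinReg 6) hadamard
  have hSi := isQuantumOp_unitary (coinPosReg 6) (shift 6)
  obtain ⟨-, hα, -, hb⟩ := isBoundedLoop_walkLoop_six
  have h := errorLE_loopSem (posReg 6) (walkMeasurement 6) (hSn.comp hHn) (hSi.comp hHi)
    (add_nonneg (NNReal.coe_nonneg _) (NNReal.coe_nonneg _))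
    (hS.comp hH hSn hHi (NNReal.coe_nonneg _)) hα hb
  refine Eq.mp (congrArg _ ?_) h
  push_cast
  norm_num
  -- the two sides differ only by unfolding the carriers of the registers
  rfl

theorem ErrorLE.isRobust {n : Type} [Fintype n] [DecidableEq n] {P : NoisyProg n} {ε : ℝ≥0}
    (h : ErrorLE P.sem P.ideal.sem ε) (Q : Matrix n n ℂ) (lam : ℝ) : P.IsRobust Q lam ε :=
  (h.qDiamondDist_le Q lam).trans_eq (ENNReal.ofReal_coe_nnreal)

end Walk

end QuantumWhile

theorem mainTheorem7 (pH pS : unitInterval) (ΦH : QuantumWhile.QuantumOp (Fin 2))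
    (ΦS : QuantumWhile.QuantumOp (Fin 2 × ZMod 6)) :
    (QuantumWhile.walkLoop 6).IsBoundedLoop (5 / 6) 5 ∧
    (QuantumWhile.noisyWalkLoop 6 pH pS ΦH ΦS).IsRobust 1 0
      (30 * (QuantumWhile.unitaryError QuantumWhile.hadamard pH ΦH +
        QuantumWhile.unitaryError (QuantumWhile.shift 6) pS ΦS)) ∧
    (QuantumWhile.noisyWalk 6 pH pS ΦH ΦS).IsRobust 1 0
      (30 * (QuantumWhile.unitaryError QuantumWhile.hadamard pH ΦH +
        QuantumWhile.unitaryError (QuantumWhile.shift 6) pS ΦS)) := by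
  open QuantumWhile in
  have h := errorLE_walkLoop_six pH pS ΦH ΦS
  refine ⟨isBoundedLoop_walkLoop_six, h.isRobust 1 0, ErrorLE.isRobust ?_ 1 0⟩
  -- The initializations are noiseless, so they do not increase the error.
  exact (h.comp_right (isQuantumOp_initSem (coinReg 6) _) (NNReal.coe_nonneg _)).comp_right
    (isQuantumOp_initSem (posReg 6) _) (NNReal.coe_nonneg _)
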